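/- **Setting.** There are $N$ renewal systems in slotted time $t\in\{0,1,2,\dots\}$ and $L$ constraints. System $n$ has renewal times $0=t^n_0<t^n_1<t^n_2<\cdots$; its $k$-th frame is $\mathcal T^n_k=\{t^n_k,\dots,t^n_{k+1}-1\}$, of duration $T^n_k=t^n_{k+1}-t^n_k\ge 1$. At $t^n_k$ it takes a (possibly random, possibly history dependent) decision $\alpha^n_k$ in a set $\mathcal A^n$. In each slot it produces a penalty $y^n[t]\in\mathbb R$ and metrics $\mathbf z^n[t]\in\mathbb R^L$. Renewal property: conditionally on the decision $\alpha^n_k=\alpha$ and on all information about all systems and the external process from before slot $t^n_k$, the frame outcome $\big(T^n_k,(y^n[t],\mathbf z^n[t])_{t\in\mathcal T^n_k}\big)$ has a law that depends only on $n$ and $\alpha$. An external i.i.d. process $\mathbf d[t]\in\mathbb R^L$, with mean $(d_1,\dots,d_L)$, is such that $\mathbf d[t]$ is independent of everything that happened before slot $t$. Write $\widehat y^n(\alpha)$, $\widehat{\mathbf z}^n(\alpha)$, $\widehat T^n(\alpha)$ for the expectations, under action $\alpha$, of the frame sum of $y^n$, the frame sum of $\mathbf z^n$, and the frame duration. Let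 $\mathcal S^n$ be the convex hull of $\{(\widehat y^n(\alpha),\widehat{\mathbf z}^n(\alpha),\widehat T^n(\alpha)):\alpha\in\mathcal A^n\}$ and let $\mathcal P^n=\{(y/T,\mathbf z/T):(y,\mathbf z,T)\in\mathcal S^n\}$. **Optimization problem.** Minimize $\limsup_{T\to\infty}\frac1T\sum_{t=0}^{T-1}\sum_{n=1}^N\mathbb E\,y^n[t]$ over all decision sequences, subject to $\limsup_{T\to\infty}\frac1T\sum_{t=0}^{T-1}\sum_{n=1}^N\mathbb E\,z^n_l[t]\le d_l$ for $l=1,\dots,L$. When the problem is feasible, $f_*$ denotes the infimum of the objective over all decision sequences that satisfy the constraints. **Algorithm with parameter $V>0$.** The virtual queues are $Q_l[0]=0$ and $Q_l[t+1]=\max\{Q_l[t]+\sum_n z^n_l[t]-d_l[t],0\}$. At $t^n_k$, system $n$ takes a decision that minimizes over $\alpha\in\mathcal A^n$ the ratio $$\frac{\mathbb E\big[\sum_{t\in\mathcal T^n_k}\big(V y^n[t]+\langle \mathbf Q[t^n_k],\mathbf z^n[t]\rangle\big)\,\big|\,\alpha^n_k=\alpha,\ \mathbf Q[t^n_k]\big]}{\mathbb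 E\big[T^n_k\,\big|\,\alpha^n_k=\alpha,\ \mathbf Q[t^n_k]\big]}.$$ **Assumptions.** 1. The problem is feasible. 2. $|y^n[t]|\le y_{\max}$, $|z^n_l[t]|\le z_{\max}$, $|d_l[t]|\le d_{\max}$, and there is $B\ge1$ such that, for all $n$, all $\alpha\in\mathcal A^n$ and all $s\in\mathbb N$ with $\Pr(T^n_k\ge s\mid\alpha^n_k=\alpha)>0$, $\mathbb E[(T^n_k-s)^2\mid \alpha^n_k=\alpha,\ T^n_k\ge s]\le B$. 3. For each $n$ the set $\{(\widehat y^n(\alpha)/\widehat T^n(\alpha),\widehat{\mathbf z}^n(\alpha)/\widehat T^n(\alpha)):\alpha\in\mathcal A^n\}$ is compact. 4. There are $\gamma_1,\dots,\gamma_L\ge0$ such that, for all $(\overline f^n,\overline{\mathbf g}^n)\in\mathcal P^n$, $n=1,\dots,N$, $$\sum_{n=1}^N\overline f^n+\sum_{l=1}^L\gamma_l\sum_{n=1}^N\overline g^n_l\ \ge\ f_*+\sum_{l=1}^L\gamma_l d_l .$$ **Theorem.** There is a constant $C\ge 0$, depending only on $N,L,y_{\max},z_{\max},d_{\max},B$ and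 $\gamma$, such that for every $\varepsilon\in(0,1)$, if the algorithm is run with $V=1/\varepsilon$, then for every integer $T\ge1/\varepsilon^2$ $$\frac1T\sum_{t=0}^{T-1}\sum_{n=1}^N\mathbb E\,y^n[t]\le f_*+C\varepsilon,\qquad \frac1T\sum_{t=0}^{T-1}\sum_{n=1}^N\mathbb E\,z^n_l[t]\le d_l+C\varepsilon\quad(l=1,\dots,L).$$ That is, the algorithm provides an $O(\varepsilon)$ approximation with convergence time $O(1/\varepsilon^2)$. -/

import Mathlib

open MeasureTheory ProbabilityTheory Filter Finset
open scoped ENNReal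

universe u v

namespace AsyncRenewal

/-- The outcome of one renewal frame, `(duration, penalties, metrics)`: the number of slots of the
frame, the penalty in its `i`-th slot and the vector of `L` metrics in its `i`-th slot.
Only the slots `i < duration` belong to the frame; the later entries are padded with `0`
(see `Model.frame_ae`). -/
abbrev Frame (L : ℕ) : Type := ℕ × (ℕ → ℝ) × (ℕ → Fin L → ℝ)

/-- The data of `N` renewal systems with `L` constraints: the action sets, the law of a frame
under each action, and the common law of the external i.i.d. process `d[t]`. -/
structure Model (N L : ℕ) where
  Action : Fin N → Type u
  [measurableAction : ∀ n, MeasurableSpace (Action n)]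
  frameLaw : ∀ n, Kernel (Action n) (Frame L)
  [markov : ∀ n, IsMarkovKernel (frameLaw n)]
  /-- A frame lasts at least one slot; the entries after its end are padded with `0`. -/
  frame_ae : ∀ n a, ∀ᵐ o ∂(frameLaw n a),
    1 ≤ o.1 ∧ ∀ i, o.1 ≤ i → o.2.1 i = 0 ∧ o.2.2 i = 0
  extLaw : Measure (Fin L → ℝ)
  [probExt : IsProbabilityMeasure extLaw]

attribute [instance] Model.measurableAction Model.markov Model.probExt

noncomputable section

namespace Model

variable {N L : ℕ} (M : Model.{u} N L)

/-- `d_l`, the mean of the external process. -/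
def dMean (l : Fin L) : ℝ := ∫ x, x l ∂M.extLaw

/-- `ŷⁿ(a)`, the expected total penalty of a frame under action `a`. -/
def yHat (n : Fin N) (a : M.Action n) : ℝ :=
  ∫ o, ∑ i ∈ range o.1, o.2.1 i ∂(M.frameLaw n a)

/-- `ẑⁿ(a)`, the expected total metrics of a frame under action `a`. -/
def zHat (n : Fin N) (a : M.Action n) (l : Fin L) : ℝ :=
  ∫ o, ∑ i ∈ range o.1, o.2.2 i l ∂(M.frameLaw n a)

/-- `T̂ⁿ(a)`, the expected duration of a frame under action `a`. -/
def tHat (n : Fin N) (a : M.Action n) : ℝ := ∫ o, (o.1 : ℝ) ∂(M.frameLaw n a)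

/-- The performance vector `(f̂ⁿ(a), ĝⁿ(a))` of the action `a`. -/
def perfVector (n : Fin N) (a : M.Action n) : ℝ × (Fin L → ℝ) :=
  (M.yHat n a / M.tHat n a, fun l => M.zHat n a l / M.tHat n a)

/-- `Sⁿ`, the convex hull of the vectors `(ŷⁿ(a), ẑⁿ(a), T̂ⁿ(a))`. -/
def frameRegion (n : Fin N) : Set (ℝ × (Fin L → ℝ) × ℝ) :=
  convexHull ℝ (Set.range fun a : M.Action n => (M.yHat n a, M.zHat n a, M.tHat n a))

/-- `Pⁿ`, the performance region of system `n`. -/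
def perfRegion (n : Fin N) : Set (ℝ × (Fin L → ℝ)) :=
  (fun p : ℝ × (Fin L → ℝ) × ℝ => (p.1 / p.2.2, fun l => p.2.1 l / p.2.2)) '' M.frameRegion n

/-- Boundedness: bounds on penalties, metrics and the external process, and the second moment
bound `E[(T - s)² | T ≥ s] ≤ B` on the residual life of a frame. -/
structure IsBounded (ymax zmax dmax B : ℝ) : Prop where
  one_le : 1 ≤ B
  penalty : ∀ n a, ∀ᵐ o ∂(M.frameLaw n a), ∀ i < o.1, |o.2.1 i| ≤ ymax
  metric : ∀ n a, ∀ᵐ o ∂(M.frameLaw n a), ∀ i < o.1, ∀ l, |o.2.2 i l| ≤ zmax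
  ext : ∀ᵐ x ∂M.extLaw, ∀ l, |x l| ≤ dmax
  residual : ∀ n a (s : ℕ), M.frameLaw n a {o | s ≤ o.1} ≠ 0 →
    ∫⁻ o, ((o.1 - s : ℕ) : ℝ≥0∞) ^ 2 ∂(cond (M.frameLaw n a) {o | s ≤ o.1}) ≤ ENNReal.ofReal B

/-- For each system the set of performance vectors is compact. -/
def HasCompactPerf : Prop := ∀ n, IsCompact (Set.range (M.perfVector n))

/-- The ratio to be minimized at the start of a frame of system `n` when the virtual queue vector
is `q`: expected frame sum of `V y + ⟨q, z⟩` over expected frame duration, under action `a`. -/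
def dppRatio (V : ℝ) (q : Fin L → ℝ) (n : Fin N) (a : M.Action n) : ℝ :=
  (∫ o, ∑ i ∈ range o.1, (V * o.2.1 i + ∑ l, q l * o.2.2 i l) ∂(M.frameLaw n a)) /
    ∫ o, (o.1 : ℝ) ∂(M.frameLaw n a)

end Model

/-- The random variables of the `N` systems run under some decision rule, on a sample space `Ω`:
renewal times `tⁿ_k`, decisions `αⁿ_k`, penalties `yⁿ[t]`, metrics `zⁿ[t]`, external process
`d[t]`. -/
structure SystemRun {N L : ℕ} (M : Model.{u} N L) (Ω : Type v) where
  renewal : Fin N → ℕ → Ω → ℕ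
  action : ∀ n : Fin N, ℕ → Ω → M.Action n
  penalty : Fin N → ℕ → Ω → ℝ
  metric : Fin N → ℕ → Ω → Fin L → ℝ
  ext : ℕ → Ω → Fin L → ℝ

namespace SystemRun

variable {N L : ℕ} {M : Model.{u} N L} {Ω : Type v} (X : SystemRun M Ω)

/-- The duration `Tⁿ_k` of the `k`-th frame of system `n`. -/
def duration (n : Fin N) (k : ℕ) (ω : Ω) : ℕ := X.renewal n (k + 1) ω - X.renewal n k ω

/-- The outcome of the `k`-th frame of system `n`. -/
def frame (n : Fin N) (k : ℕ) (ω : Ω) : Frame L :=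
  (X.duration n k ω,
   fun i => if i < X.duration n k ω then X.penalty n (X.renewal n k ω + i) ω else 0,
   fun i => if i < X.duration n k ω then X.metric n (X.renewal n k ω + i) ω else 0)

/-- The information available at the beginning of slot `t`: the penalties, metrics and external
variables of all slots `s < t`, the renewals of all systems that have occurred up to slot `t`, and
the decisions taken at renewals in slots `s < t`. -/
@[reducible] def history (t : ℕ) : MeasurableSpace Ω :=
  (⨆ (n : Fin N) (s : ℕ) (_ : s < t), MeasurableSpace.comap (X.penalty n s) inferInstance) ⊔
  (⨆ (n : Fin N) (s : ℕ) (_ : s < t), MeasurableSpace.comap (X.metric n s) inferInstance) ⊔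
  (⨆ (s : ℕ) (_ : s < t), MeasurableSpace.comap (X.ext s) inferInstance) ⊔
  MeasurableSpace.generateFrom
    {E | ∃ (n : Fin N) (k s : ℕ), s ≤ t ∧ E = {ω | X.renewal n k ω = s}} ⊔
  MeasurableSpace.generateFrom
    {E | ∃ (n : Fin N) (k s : ℕ) (S : Set (M.Action n)), s < t ∧ MeasurableSet S ∧
      E = {ω | X.renewal n k ω = s ∧ X.action n k ω ∈ S}}

/-- `X` is a run of the renewal systems of `M` under the probability measure `P`, with arbitrary
(possibly random, possibly history dependent) decisions.
The field `renewal_property` says that, conditionally on everything that happened before the slot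
`tⁿ_k` and on the decision `αⁿ_k`, the outcome of the `k`-th frame of system `n` has the law
attached to that decision. The last two fields say that `d[t]` is an external i.i.d. process: it
has the given law and is independent of everything that happened before slot `t`. -/
structure IsValid [MeasurableSpace Ω] (P : Measure Ω) : Prop where
  measurable_renewal : ∀ n k, Measurable (X.renewal n k)
  measurable_action : ∀ n k, Measurable (X.action n k)
  measurable_penalty : ∀ n t, Measurable (X.penalty n t)
  measurable_metric : ∀ n t, Measurable (X.metric n t)
  measurable_ext : ∀ t, Measurable (X.ext t)
  renewal_zero : ∀ n ω, X.renewal n 0 ω = 0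
  renewal_lt : ∀ n k ω, X.renewal n k ω < X.renewal n (k + 1) ω
  renewal_property : ∀ (n : Fin N) (k t : ℕ) (E : Set Ω), MeasurableSet[X.history t] E →
    ∀ (S : Set (M.Action n)), MeasurableSet S → ∀ (U : Set (Frame L)), MeasurableSet U →
      P {ω | ω ∈ E ∧ X.renewal n k ω = t ∧ X.action n k ω ∈ S ∧ X.frame n k ω ∈ U} =
        ∫⁻ ω in {ω | ω ∈ E ∧ X.renewal n k ω = t ∧ X.action n k ω ∈ S},
          M.frameLaw n (X.action n k ω) U ∂P
  ext_law : ∀ t, P.map (X.ext t) = M.extLaw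
  ext_indep : ∀ t, Indep (MeasurableSpace.comap (X.ext t) inferInstance) (X.history t) P

/-- The virtual queues `Q[t]`. -/
def queue : ℕ → Ω → Fin L → ℝ
  | 0 => fun _ _ => 0
  | t + 1 => fun ω l => max (queue t ω l + ∑ n, X.metric n t ω l - X.ext t ω l) 0

/-- The decisions are those of the proposed algorithm with parameter `V`: at the start of each
frame, the action minimizes the ratio for the current virtual queue vector. -/
def FollowsAlgorithm [MeasurableSpace Ω] (P : Measure Ω) (V : ℝ) : Prop :=
  ∀ n k, ∀ᵐ ω ∂P, ∀ a : M.Action n,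
    M.dppRatio V (X.queue (X.renewal n k ω) ω) n (X.action n k ω) ≤
      M.dppRatio V (X.queue (X.renewal n k ω) ω) n a

/-- `(1/T) ∑_{t<T} ∑ₙ E[yⁿ[t]]`. -/
def avgPenalty [MeasurableSpace Ω] (P : Measure Ω) (T : ℕ) : ℝ :=
  (1 / (T : ℝ)) * ∑ t ∈ range T, ∑ n, ∫ ω, X.penalty n t ω ∂P

/-- `(1/T) ∑_{t<T} ∑ₙ E[zⁿ_l[t]]`. -/
def avgMetric [MeasurableSpace Ω] (P : Measure Ω) (l : Fin L) (T : ℕ) : ℝ :=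
  (1 / (T : ℝ)) * ∑ t ∈ range T, ∑ n, ∫ ω, X.metric n t ω l ∂P

/-- The long-run constraints of the stochastic optimization problem. -/
def SatisfiesConstraints [MeasurableSpace Ω] (P : Measure Ω) : Prop :=
  ∀ l, limsup (X.avgMetric P l) atTop ≤ M.dMean l

end SystemRun

namespace Model

variable {N L : ℕ} (M : Model.{u} N L)

/-- The objective values of all runs that satisfy the constraints, over all probability spaces. -/
def feasibleValues : Set ℝ :=
  {c | ∃ (Ω : Type u) (_ : MeasurableSpace Ω) (P : Measure Ω) (X : SystemRun M Ω),
    IsProbabilityMeasure P ∧ X.IsValid P ∧ X.SatisfiesConstraints P ∧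
      c = limsup (X.avgPenalty P) atTop}

/-- The stochastic optimization problem is feasible. -/
def IsFeasible : Prop := M.feasibleValues.Nonempty

/-- `f_*`, the infimum of the objective over all runs that satisfy the constraints. -/
def optValue : ℝ := sInf M.feasibleValues

/-- `γ` is a vector of Lagrange multipliers: `(1, γ)` is the normal vector of a separating
hyperplane at `(f_*, d)` for the sums of points of the performance regions. -/
def IsLagrangeMultiplier (γ : Fin L → ℝ) : Prop :=
  (∀ l, 0 ≤ γ l) ∧
  ∀ p : Fin N → ℝ × (Fin L → ℝ), (∀ n, p n ∈ M.perfRegion n) →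
    M.optValue + ∑ l, γ l * M.dMean l ≤ ∑ n, (p n).1 + ∑ l, γ l * ∑ n, (p n).2 l

end Model

end

end AsyncRenewal

/-! The proof is a drift-plus-penalty argument with the Lyapunov function `½ ∑ Q_l²`, adapted to
systems whose frames do not align. For each system, `bestRatio V n q` is the infimum over actions of
the ratio at queue vector `q`; it is Lipschitz in `q`.

The frame estimate `IsValid.sum_integral_le` handles asynchrony one system at a time. Given the
history at the start of a frame and the decision, the expected frame cost minus (bound on the ratio)
× (duration) is nonpositive. Summing over frames leaves two errors. Cutting the last frame at `T`
costs a bounded residual life. Freezing the queue during a frame costs a multiple of the squared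
duration, which the second moment bound makes `O(1)` per frame.

The estimate is used twice. With the queue as weight, it shows that the algorithm pays at most
`bestRatio V n Q[t]` per slot up to a constant (`algorithm_cost_le`). With negated costs and a fixed
weight, it shows that no run can beat `bestRatio` by more than a constant in total
(`mul_sum_bestRatio_le`). For feasible runs the latter gives weak duality, `∑ₙ bestRatio V n q ≤ V
f_* + ⟨q, d⟩`; for the algorithm's own run with weights `(1, γ)`, it combines with the multiplier
inequality to give `f_* + ⟨γ, d⟩ ≤ S + ⟨γ, z⟩ + O(1/T)`, where `S` and `z` are the averages up to
`T`.

Weak duality at `q = Q[t]` in every slot gives `V T S + ½ E|Q[T]|² ≤ V T f_* + O(T) + O(V)`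
(`drift_plus_penalty_le`). Dropping the queue term bounds the penalty. Inserting the lower bound on
`S`, with `T (z - d) ≤ E Q[T]`, bounds `E|Q[T]|²` by `O(T + V²)`, which is `O(T)` when `T ≥ V²`; so
`E Q_l[T] = O(√T)`, and the violation `E Q_l[T] / T` is `O(ε)`. -/

namespace AsyncRenewal

noncomputable section

/-! ### Frame costs and their bounds. -/

/-- Total cost `∑ (V y + ⟨q, z⟩)` of a frame. -/
def frameCost {L : ℕ} (V : ℝ) (q : Fin L → ℝ) (o : Frame L) : ℝ :=
  ∑ i ∈ range o.1, (V * o.2.1 i + ∑ l, q l * o.2.2 i l)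

/-- Joint measurability in the weight is needed because the weight will be a random queue vector. -/
theorem measurable_frameCost {L : ℕ} (V : ℝ) :
    Measurable fun p : (Fin L → ℝ) × Frame L => frameCost V p.1 p.2 := by
  have h : Measurable fun p : ℕ × ((Fin L → ℝ) × Frame L) =>
      ∑ i ∈ range p.1, (V * p.2.2.2.1 i + ∑ l, p.2.1 l * p.2.2.2.2 i l) := by
    refine measurable_from_prod_countable_right fun n => ?_
    dsimp only
    fun_prop
  exact h.comp (by fun_prop : Measurable fun p : (Fin L → ℝ) × Frame L => (p.2.1, p))

theorem measurable_frameCost_right {L : ℕ} (V : ℝ) (q : Fin L → ℝ) :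
    Measurable (frameCost V q) :=
  (measurable_frameCost V).comp (by fun_prop : Measurable fun o : Frame L => (q, o))

theorem abs_slotCost_le {L : ℕ} {V Y Z R y : ℝ} {q z : Fin L → ℝ} (hy : |y| ≤ Y)
    (hz : ∀ l, |z l| ≤ Z) (hq : ∀ l, |q l| ≤ R) :
    |V * y + ∑ l, q l * z l| ≤ |V| * Y + L * R * Z := by
  refine (abs_add_le _ _).trans (add_le_add ?_ ?_)
  · rw [abs_mul]; gcongr
  · calc |∑ l, q l * z l| ≤ ∑ l, |q l * z l| := Finset.abs_sum_le_sum_abs _ _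
      _ ≤ ∑ _l : Fin L, R * Z := by
        refine Finset.sum_le_sum fun l _ => ?_
        rw [abs_mul]
        exact mul_le_mul (hq l) (hz l) (abs_nonneg _) ((abs_nonneg _).trans (hq l))
      _ = L * R * Z := by simp; ring

theorem abs_frameCost_le {L : ℕ} {V Y Z R : ℝ} {q : Fin L → ℝ} {o : Frame L}
    (hy : ∀ i < o.1, |o.2.1 i| ≤ Y) (hz : ∀ i < o.1, ∀ l, |o.2.2 i l| ≤ Z)
    (hq : ∀ l, |q l| ≤ R) : |frameCost V q o| ≤ (|V| * Y + L * R * Z) * o.1 := by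
  refine (Finset.abs_sum_le_sum_abs _ _).trans ?_
  calc _ ≤ ∑ _i ∈ range o.1, (|V| * Y + L * R * Z) :=
        Finset.sum_le_sum fun i hi =>
          abs_slotCost_le (hy i (Finset.mem_range.1 hi)) (hz i (Finset.mem_range.1 hi)) hq
    _ = _ := by simp; ring

/-! ### The minimized ratio as a function of the queue vector. -/

namespace Model

variable {N L : ℕ} {M : Model.{u} N L} {Y Z D B : ℝ}

/-- The given bounds may be negative when there are no systems or no constraints; absolute values
make all later constants nonnegative. -/
theorem IsBounded.abs (h : M.IsBounded Y Z D B) : M.IsBounded |Y| |Z| |D| B where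
  one_le := h.one_le
  penalty n a := by
    filter_upwards [h.penalty n a] with o ho i hi using (ho i hi).trans (le_abs_self _)
  metric n a := by
    filter_upwards [h.metric n a] with o ho i hi l using (ho i hi l).trans (le_abs_self _)
  ext := by filter_upwards [h.ext] with x hx l using (hx l).trans (le_abs_self _)
  residual := h.residual

/-- The truncated difference vanishes off `{s ≤ T}`, so the conditional moment bound becomes an
unconditional one that keeps the probability of the event as a factor. This factor is what later
sums to at most one over the frames straddling the horizon. -/
theorem IsBounded.lintegral_residual_sq_le (h : M.IsBounded Y Z D B) (n : Fin N)
    (a : M.Action n) (s : ℕ) :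
    ∫⁻ o, ((o.1 - s : ℕ) : ℝ≥0∞) ^ 2 ∂(M.frameLaw n a) ≤
      ENNReal.ofReal B * M.frameLaw n a {o | s ≤ o.1} := by
  have hA : MeasurableSet {o : Frame L | s ≤ o.1} := measurable_fst measurableSet_Ici
  have hcompl : ∫⁻ o, ((o.1 - s : ℕ) : ℝ≥0∞) ^ 2 ∂(M.frameLaw n a) =
      ∫⁻ o in {o | s ≤ o.1}, ((o.1 - s : ℕ) : ℝ≥0∞) ^ 2 ∂(M.frameLaw n a) := by
    rw [← lintegral_indicator hA]
    refine lintegral_congr fun o => ?_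
    by_cases ho : s ≤ o.1
    · simp [Set.indicator, ho]
    · have : o.1 - s = 0 := by omega
      simp [Set.indicator, ho, this]
  rw [hcompl]
  by_cases h0 : M.frameLaw n a {o | s ≤ o.1} = 0
  · rw [Measure.restrict_eq_zero.2 h0]; simp
  · have := h.residual n a s h0
    rw [ProbabilityTheory.cond, lintegral_smul_measure, smul_eq_mul] at this
    rw [mul_comm]
    exact (ENNReal.inv_mul_le_iff h0 (measure_ne_top _ _)).1 this

theorem IsBounded.lintegral_residual_le (h : M.IsBounded Y Z D B) (n : Fin N)
    (a : M.Action n) (s : ℕ) :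
    ∫⁻ o, ((o.1 - s : ℕ) : ℝ≥0∞) ∂(M.frameLaw n a) ≤
      ENNReal.ofReal B * M.frameLaw n a {o | s ≤ o.1} := by
  refine le_trans (lintegral_mono fun o => ?_) (h.lintegral_residual_sq_le n a s)
  rw [← Nat.cast_pow]
  exact Nat.cast_le.2 (Nat.le_self_pow two_ne_zero _)

theorem IsBounded.lintegral_duration_sq_le (h : M.IsBounded Y Z D B) (n : Fin N)
    (a : M.Action n) :
    ∫⁻ o, (o.1 : ℝ≥0∞) ^ 2 ∂(M.frameLaw n a) ≤ ENNReal.ofReal B := by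
  simpa using h.lintegral_residual_sq_le n a 0

theorem IsBounded.integrable_duration (h : M.IsBounded Y Z D B) (n : Fin N) (a : M.Action n) :
    Integrable (fun o : Frame L => (o.1 : ℝ)) (M.frameLaw n a) := by
  refine ⟨(by fun_prop : Measurable fun o : Frame L => (o.1 : ℝ)).aestronglyMeasurable, ?_⟩
  have := h.lintegral_residual_le n a 0
  simp only [Nat.sub_zero] at this
  refine lt_of_le_of_lt ?_ (lt_of_le_of_lt this (ENNReal.mul_lt_top ENNReal.ofReal_lt_top
    (measure_lt_top _ _)))
  refine lintegral_mono fun o => ?_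
  rw [Real.enorm_natCast]

theorem IsBounded.one_le_tHat (h : M.IsBounded Y Z D B) (n : Fin N) (a : M.Action n) :
    1 ≤ M.tHat n a := by
  calc (1 : ℝ) = ∫ _o, (1 : ℝ) ∂(M.frameLaw n a) := by simp
    _ ≤ M.tHat n a := by
      refine integral_mono_ae (integrable_const _) (h.integrable_duration n a) ?_
      filter_upwards [M.frame_ae n a] with o ho
      exact_mod_cast ho.1

theorem IsBounded.integrable_of_abs_le (h : M.IsBounded Y Z D B) (n : Fin N) (a : M.Action n)
    {g : Frame L → ℝ} (hg : Measurable g) {K : ℝ}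
    (hK : ∀ᵐ o ∂(M.frameLaw n a), |g o| ≤ K * o.1) : Integrable g (M.frameLaw n a) :=
  ((h.integrable_duration n a).const_mul K).mono' hg.aestronglyMeasurable hK

theorem IsBounded.abs_integral_div_le (h : M.IsBounded Y Z D B) (n : Fin N) (a : M.Action n)
    {g : Frame L → ℝ} {K : ℝ} (hK : ∀ᵐ o ∂(M.frameLaw n a), |g o| ≤ K * o.1) :
    |(∫ o, g o ∂(M.frameLaw n a)) / M.tHat n a| ≤ K := by
  have ht : 0 < M.tHat n a := lt_of_lt_of_le one_pos (h.one_le_tHat n a)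
  rw [abs_div, abs_of_pos ht, div_le_iff₀ ht]
  calc ‖∫ o, g o ∂(M.frameLaw n a)‖ ≤ ∫ o, K * (o.1 : ℝ) ∂(M.frameLaw n a) :=
        norm_integral_le_of_norm_le ((h.integrable_duration n a).const_mul K) hK
    _ = K * M.tHat n a := integral_const_mul _ _

theorem IsBounded.ae_abs_penaltySum_le (h : M.IsBounded Y Z D B) (n : Fin N) (a : M.Action n) :
    ∀ᵐ o ∂(M.frameLaw n a), |∑ i ∈ range o.1, o.2.1 i| ≤ Y * o.1 := by
  filter_upwards [h.penalty n a] with o ho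
  refine (Finset.abs_sum_le_sum_abs _ _).trans ?_
  refine (Finset.sum_le_sum fun i hi => ho i (Finset.mem_range.1 hi)).trans (le_of_eq ?_)
  simp [mul_comm]

theorem IsBounded.ae_abs_metricSum_le (h : M.IsBounded Y Z D B) (n : Fin N) (a : M.Action n)
    (l : Fin L) : ∀ᵐ o ∂(M.frameLaw n a), |∑ i ∈ range o.1, o.2.2 i l| ≤ Z * o.1 := by
  filter_upwards [h.metric n a] with o ho
  refine (Finset.abs_sum_le_sum_abs _ _).trans ?_
  refine (Finset.sum_le_sum fun i hi => ho i (Finset.mem_range.1 hi) l).trans (le_of_eq ?_)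
  simp [mul_comm]

theorem measurable_penaltySum :
    Measurable fun o : Frame L => ∑ i ∈ range o.1, o.2.1 i := by
  simpa +unfoldPartialApp [frameCost] using measurable_frameCost_right (L := L) 1 0

theorem measurable_metricSum (l : Fin L) :
    Measurable fun o : Frame L => ∑ i ∈ range o.1, o.2.2 i l := by
  simpa +unfoldPartialApp [frameCost, Pi.single_apply] using measurable_frameCost_right (L := L) 0 (Pi.single l 1)

/-- Linearity in `(V, q)` gives both the Lipschitz dependence on the queue vector and the link with
the multiplier inequality, which speaks of performance vectors. -/
theorem IsBounded.dppRatio_eq (h : M.IsBounded Y Z D B) (V : ℝ) (q : Fin L → ℝ) (n : Fin N)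
    (a : M.Action n) :
    M.dppRatio V q n a = V * (M.perfVector n a).1 + ∑ l, q l * (M.perfVector n a).2 l := by
  have e : ∀ o : Frame L, ∑ i ∈ range o.1, (V * o.2.1 i + ∑ l, q l * o.2.2 i l) =
      V * ∑ i ∈ range o.1, o.2.1 i + ∑ l, q l * ∑ i ∈ range o.1, o.2.2 i l := by
    intro o
    rw [Finset.sum_add_distrib, Finset.mul_sum, Finset.sum_comm]
    simp [Finset.mul_sum]
  have hy := h.integrable_of_abs_le n a measurable_penaltySum (h.ae_abs_penaltySum_le n a)
  have hz := fun l =>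
    h.integrable_of_abs_le n a (measurable_metricSum l) (h.ae_abs_metricSum_le n a l)
  unfold dppRatio perfVector yHat zHat tHat
  simp_rw [e]
  rw [integral_add (hy.const_mul V) (integrable_finsetSum _ fun l _ => (hz l).const_mul _),
    integral_finsetSum _ fun l _ => (hz l).const_mul _, add_div, integral_const_mul,
    Finset.sum_div]
  simp_rw [integral_const_mul, mul_div_assoc]

theorem IsBounded.abs_perf_fst_le (h : M.IsBounded Y Z D B) (n : Fin N) (a : M.Action n) :
    |(M.perfVector n a).1| ≤ Y :=
  h.abs_integral_div_le n a (h.ae_abs_penaltySum_le n a)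

theorem IsBounded.abs_perf_snd_le (h : M.IsBounded Y Z D B) (n : Fin N) (a : M.Action n)
    (l : Fin L) : |(M.perfVector n a).2 l| ≤ Z :=
  h.abs_integral_div_le n a (h.ae_abs_metricSum_le n a l)

theorem IsBounded.abs_dppRatio_le (h : M.IsBounded Y Z D B) {V R : ℝ} {q : Fin L → ℝ}
    (hq : ∀ l, |q l| ≤ R) (n : Fin N) (a : M.Action n) :
    |M.dppRatio V q n a| ≤ |V| * Y + L * R * Z := by
  rw [h.dppRatio_eq]
  exact abs_slotCost_le (h.abs_perf_fst_le n a) (h.abs_perf_snd_le n a) hq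

theorem IsBounded.dppRatio_le_add (h : M.IsBounded Y Z D B) {V R : ℝ} {q q' : Fin L → ℝ}
    (hq : ∀ l, |q l - q' l| ≤ R) (n : Fin N) (a : M.Action n) :
    M.dppRatio V q n a ≤ M.dppRatio V q' n a + L * R * Z := by
  have h1 : |M.dppRatio 0 (q - q') n a| ≤ |(0 : ℝ)| * Y + L * R * Z :=
    h.abs_dppRatio_le (fun l => hq l) n a
  have h2 : M.dppRatio 0 (q - q') n a = M.dppRatio V q n a - M.dppRatio V q' n a := by
    simp only [h.dppRatio_eq, Pi.sub_apply, sub_mul, Finset.sum_sub_distrib]; ring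
  rw [h2, abs_zero, zero_mul, zero_add] at h1
  linarith [le_abs_self (M.dppRatio V q n a - M.dppRatio V q' n a)]

/-- The optimal value of the ratio minimized at the start of a frame of system `n`. -/
def bestRatio (M : Model.{u} N L) (V : ℝ) (n : Fin N) (q : Fin L → ℝ) : ℝ := ⨅ a, M.dppRatio V q n a

theorem IsBounded.bddBelow_dppRatio (h : M.IsBounded Y Z D B) (V : ℝ) (q : Fin L → ℝ)
    (n : Fin N) : BddBelow (Set.range fun a => M.dppRatio V q n a) := by
  refine ⟨-(|V| * Y + L * ‖q‖ * Z), ?_⟩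
  rintro _ ⟨a, rfl⟩
  exact (abs_le.1 (h.abs_dppRatio_le (fun l => norm_le_pi_norm q l) n a)).1

theorem IsBounded.bestRatio_le (h : M.IsBounded Y Z D B) (V : ℝ) (n : Fin N) (q : Fin L → ℝ)
    (a : M.Action n) : M.bestRatio V n q ≤ M.dppRatio V q n a :=
  ciInf_le (h.bddBelow_dppRatio V q n) a

theorem IsBounded.abs_bestRatio_le (h : M.IsBounded Y Z D B) {V R : ℝ} {q : Fin L → ℝ}
    (hq : ∀ l, |q l| ≤ R) (n : Fin N) [Nonempty (M.Action n)] :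
    |M.bestRatio V n q| ≤ |V| * Y + L * R * Z := by
  refine abs_le.2 ⟨le_ciInf fun a => (abs_le.1 (h.abs_dppRatio_le hq n a)).1, ?_⟩
  exact (h.bestRatio_le V n q (Classical.arbitrary _)).trans
    (abs_le.1 (h.abs_dppRatio_le hq n _)).2

/-- An infimum of functions of `q` with a common Lipschitz constant. This controls the change of the
benchmark while a frame is running, and yields measurability along the queue process. -/
theorem IsBounded.bestRatio_le_add (h : M.IsBounded Y Z D B) {V R : ℝ} {q q' : Fin L → ℝ}
    (hq : ∀ l, |q l - q' l| ≤ R) (n : Fin N) [Nonempty (M.Action n)] :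
    M.bestRatio V n q ≤ M.bestRatio V n q' + L * R * Z := by
  rw [← sub_le_iff_le_add]
  refine le_ciInf fun a => ?_
  linarith [h.bestRatio_le V n q a, h.dppRatio_le_add (V := V) hq n a]

theorem IsBounded.continuous_bestRatio (h : M.IsBounded Y Z D B) (V : ℝ) (n : Fin N)
    [Nonempty (M.Action n)] : Continuous (M.bestRatio V n) := by
  have : LipschitzWith (Real.toNNReal (L * Z)) (M.bestRatio V n) := by
    refine LipschitzWith.of_le_add_mul _ fun q q' => ?_
    have := h.bestRatio_le_add (V := V) (q := q) (q' := q') (R := dist q q')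
      (fun l => dist_le_pi_dist q q' l) n
    have h2 : (L * Z) * dist q q' ≤ (Real.toNNReal (L * Z) : ℝ) * dist q q' :=
      mul_le_mul_of_nonneg_right (Real.le_coe_toNNReal _) dist_nonneg
    linarith
  exact this.continuous

/-- The multiplier inequality is applied to the performance vectors of nearly optimal actions, which
lie in the performance regions. -/
theorem IsLagrangeMultiplier.le_sum_bestRatio {γ : Fin L → ℝ} (hγ : M.IsLagrangeMultiplier γ)
    (h : M.IsBounded Y Z D B) [∀ n, Nonempty (M.Action n)] :
    M.optValue + ∑ l, γ l * M.dMean l ≤ ∑ n, M.bestRatio 1 n γ := by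
  refine le_of_forall_pos_le_add fun δ hδ => ?_
  have hN : (0 : ℝ) < N + 1 := by positivity
  -- Dividing by `N + 1` rather than `N` covers the case of no systems.
  have hex : ∀ n, ∃ a, M.dppRatio 1 γ n a < M.bestRatio 1 n γ + δ / (N + 1) := fun n =>
    exists_lt_of_ciInf_lt (lt_add_of_pos_right _ (by positivity))
  choose a ha using hex
  have h1 := hγ.2 (fun n => M.perfVector n (a n)) fun n =>
    ⟨_, subset_convexHull ℝ _ ⟨a n, rfl⟩, rfl⟩
  have h2 : ∑ n, (M.perfVector n (a n)).1 + ∑ l, γ l * ∑ n, (M.perfVector n (a n)).2 l =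
      ∑ n, M.dppRatio 1 γ n (a n) := by
    simp only [h.dppRatio_eq, one_mul, Finset.sum_add_distrib, Finset.mul_sum]
    rw [Finset.sum_comm]
  have h3 : ∑ n, M.dppRatio 1 γ n (a n) ≤ ∑ n, (M.bestRatio 1 n γ + δ / (N + 1)) :=
    Finset.sum_le_sum fun n _ => (ha n).le
  have h4 : N * (δ / (N + 1)) ≤ δ := by
    rw [← mul_div_assoc, div_le_iff₀ hN]; nlinarith
  rw [Finset.sum_add_distrib] at h3
  simp only [Finset.sum_const, Finset.card_univ, Fintype.card_fin, nsmul_eq_mul] at h3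
  linarith

end Model

/-! ### Runs: history, the law of a frame given the past, almost sure bounds. -/

namespace SystemRun

variable {N L : ℕ} {M : Model.{u} N L} {Ω : Type v} {X : SystemRun M Ω} {mΩ : MeasurableSpace Ω}
  {P : Measure Ω} {Y Z D B : ℝ}

theorem IsValid.strictMono (hX : X.IsValid P) (n : Fin N) (ω : Ω) :
    StrictMono fun k => X.renewal n k ω :=
  strictMono_nat_of_lt_succ fun k => hX.renewal_lt n k ω

theorem IsValid.renewal_succ (hX : X.IsValid P) (n : Fin N) (k : ℕ) (ω : Ω) :
    X.renewal n (k + 1) ω = X.renewal n k ω + X.duration n k ω := by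
  have := hX.renewal_lt n k ω
  unfold duration; omega

theorem IsValid.history_le (hX : X.IsValid P) (t : ℕ) : X.history t ≤ mΩ := by
  refine sup_le (sup_le (sup_le (sup_le ?_ ?_) ?_) ?_) ?_
  · exact iSup_le fun n => iSup_le fun s => iSup_le fun _ => (hX.measurable_penalty n s).comap_le
  · exact iSup_le fun n => iSup_le fun s => iSup_le fun _ => (hX.measurable_metric n s).comap_le
  · exact iSup_le fun s => iSup_le fun _ => (hX.measurable_ext s).comap_le
  · refine MeasurableSpace.generateFrom_le ?_
    rintro _ ⟨n, k, s, -, rfl⟩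
    exact hX.measurable_renewal n k (measurableSet_singleton s)
  · refine MeasurableSpace.generateFrom_le ?_
    rintro _ ⟨n, k, s, S, -, hS, rfl⟩
    exact (hX.measurable_renewal n k (measurableSet_singleton s)).inter
      (hX.measurable_action n k hS)

theorem measurable_history_metric (n : Fin N) {s t : ℕ} (h : s < t) :
    Measurable[X.history t] (X.metric n s) := by
  refine Measurable.mono (comap_measurable (X.metric n s)) ?_ le_rfl
  exact le_sup_of_le_left (le_sup_of_le_left (le_sup_of_le_left (le_sup_of_le_right
    (le_iSup_of_le n (le_iSup_of_le s (le_iSup_of_le h le_rfl))))))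

theorem measurable_history_ext {s t : ℕ} (h : s < t) :
    Measurable[X.history t] (X.ext s) := by
  refine Measurable.mono (comap_measurable (X.ext s)) ?_ le_rfl
  exact le_sup_of_le_left (le_sup_of_le_left (le_sup_of_le_right
    (le_iSup_of_le s (le_iSup_of_le h le_rfl))))

theorem measurable_history_queue (t : ℕ) : Measurable[X.history t] (X.queue t) := by
  -- The history stays at time `t` throughout the induction, so no monotonicity of `history` is
  -- needed.
  suffices h : ∀ s ≤ t, Measurable[X.history t] (X.queue s) from h t le_rfl
  intro s
  induction s with
  | zero => intro _; exact measurable_const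
  | succ s ih =>
    intro hs
    have h1 := ih (by omega)
    have h2 : ∀ n, Measurable[X.history t] (X.metric n s) := fun n =>
      measurable_history_metric n (by omega)
    have h3 : Measurable[X.history t] (X.ext s) := measurable_history_ext (by omega)
    refine @measurable_pi_lambda _ _ _ (X.history t) _ _ fun l => ?_
    refine Measurable.max (Measurable.sub (Measurable.add ((measurable_pi_apply l).comp h1)
      (Finset.measurable_fun_sum _ fun n _ => (measurable_pi_apply l).comp (h2 n)))
      ((measurable_pi_apply l).comp h3)) measurable_const

theorem IsValid.measurable_duration (hX : X.IsValid P) (n : Fin N) (k : ℕ) :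
    Measurable (X.duration n k) :=
  (hX.measurable_renewal n (k + 1)).sub (hX.measurable_renewal n k)

theorem IsValid.measurable_frame (hX : X.IsValid P) (n : Fin N) (k : ℕ) :
    Measurable (X.frame n k) := by
  have hd := hX.measurable_duration n k
  have hp : ∀ i, Measurable fun ω => X.penalty n (X.renewal n k ω + i) ω := fun i =>
    (measurable_from_prod_countable_right (f := fun p : ℕ × Ω => X.penalty n (p.1 + i) p.2)
      fun t => hX.measurable_penalty n (t + i)).comp
        ((hX.measurable_renewal n k).prodMk measurable_id)
  have hm : ∀ i, Measurable fun ω => X.metric n (X.renewal n k ω + i) ω := fun i =>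
    (measurable_from_prod_countable_right (f := fun p : ℕ × Ω => X.metric n (p.1 + i) p.2)
      fun t => hX.measurable_metric n (t + i)).comp
        ((hX.measurable_renewal n k).prodMk measurable_id)
  refine hd.prodMk (Measurable.prodMk ?_ ?_)
  · exact measurable_pi_lambda _ fun i =>
      Measurable.ite (hd measurableSet_Ioi) (hp i) measurable_const
  · exact measurable_pi_lambda _ fun i =>
      Measurable.ite (hd measurableSet_Ioi) (hm i) measurable_const

theorem IsValid.measurableSet_renewal (hX : X.IsValid P) (n : Fin N) (k t : ℕ) :
    MeasurableSet {ω | X.renewal n k ω = t} :=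
  hX.measurable_renewal n k (measurableSet_singleton t)

/-- On the event that a frame starts in slot `t`, the joint law of a history variable, the
decision and the frame outcome is obtained by drawing the outcome from the frame law. -/
theorem IsValid.map_frame_eq_compProd [IsProbabilityMeasure P] (hX : X.IsValid P) (n : Fin N)
    (k t : ℕ) {H : Type*} [MeasurableSpace H] {h : Ω → H} (hh : Measurable[X.history t] h) :
    (P.restrict {ω | X.renewal n k ω = t}).map
        (fun ω => ((h ω, X.action n k ω), X.frame n k ω)) =
      (P.restrict {ω | X.renewal n k ω = t}).map (fun ω => (h ω, X.action n k ω)) ⊗ₘ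
        (M.frameLaw n).prodMkLeft H := by
  have hh' : Measurable h := hh.mono (hX.history_le t) le_rfl
  have ha := hX.measurable_action n k
  have hf := hX.measurable_frame n k
  rw [Measure.ext_prod₃_iff']
  intro E S U hE hS hU
  rw [Measure.compProd_apply_prod (hE.prod hS) hU,
    Measure.map_apply ((hh'.prodMk ha).prodMk hf) ((hE.prod hS).prod hU),
    setLIntegral_map (hE.prod hS)
      (by exact Kernel.measurable_coe _ hU) (hh'.prodMk ha),
    Measure.restrict_apply (((hh'.prodMk ha).prodMk hf) ((hE.prod hS).prod hU)),
    Measure.restrict_restrict ((hh'.prodMk ha) (hE.prod hS))]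
  have key := hX.renewal_property n k t (h ⁻¹' E) (hh hE) S hS U hU
  convert key using 2
  · ext ω
    simp only [Set.mem_inter_iff, Set.mem_preimage, Set.mem_prod, Set.mem_ofPred_eq]
    tauto
  · congr 1
    ext ω
    simp only [Set.mem_inter_iff, Set.mem_preimage, Set.mem_prod, Set.mem_ofPred_eq]
    tauto
  · rfl

theorem IsValid.setLIntegral_frame [IsProbabilityMeasure P] (hX : X.IsValid P) (n : Fin N)
    (k t : ℕ) {g : Frame L → ℝ≥0∞} (hg : Measurable g) :
    ∫⁻ ω in {ω | X.renewal n k ω = t}, g (X.frame n k ω) ∂P =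
      ∫⁻ ω in {ω | X.renewal n k ω = t},
        ∫⁻ o, g o ∂(M.frameLaw n (X.action n k ω)) ∂P := by
  have hm := hX.map_frame_eq_compProd n k t (h := fun _ : Ω => ()) measurable_const
  have h1 : ∫⁻ x, g x.2 ∂((P.restrict {ω | X.renewal n k ω = t}).map
      (fun ω => (((), X.action n k ω), X.frame n k ω))) =
      ∫⁻ ω in {ω | X.renewal n k ω = t}, g (X.frame n k ω) ∂P :=
    lintegral_map (by fun_prop)
      ((measurable_const.prodMk (hX.measurable_action n k)).prodMk (hX.measurable_frame n k))
  rw [← h1, hm, Measure.lintegral_compProd (by fun_prop), lintegral_map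
    (Measurable.lintegral_kernel_prod_right'
      (f := fun x : (Unit × M.Action n) × Frame L => g x.2) (hg.comp measurable_snd))
    (measurable_const.prodMk (hX.measurable_action n k))]
  rfl

theorem IsValid.setIntegral_frame [IsProbabilityMeasure P] (hX : X.IsValid P) (n : Fin N)
    (k t : ℕ) {H : Type*} [MeasurableSpace H] {h : Ω → H} (hh : Measurable[X.history t] h)
    {g : H × Frame L → ℝ} (hg : Measurable g)
    (hint : IntegrableOn (fun ω => g (h ω, X.frame n k ω)) {ω | X.renewal n k ω = t} P) :
    ∫ ω in {ω | X.renewal n k ω = t}, g (h ω, X.frame n k ω) ∂P =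
      ∫ ω in {ω | X.renewal n k ω = t},
        ∫ o, g (h ω, o) ∂(M.frameLaw n (X.action n k ω)) ∂P := by
  have hh' : Measurable h := hh.mono (hX.history_le t) le_rfl
  have hm := hX.map_frame_eq_compProd n k t hh
  have hmeas : Measurable fun ω => ((h ω, X.action n k ω), X.frame n k ω) :=
    (hh'.prodMk (hX.measurable_action n k)).prodMk (hX.measurable_frame n k)
  have hG : Measurable fun x : (H × M.Action n) × Frame L => g (x.1.1, x.2) := by fun_prop
  have h1 : ∫ x, g (x.1.1, x.2) ∂((P.restrict {ω | X.renewal n k ω = t}).map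
      (fun ω => ((h ω, X.action n k ω), X.frame n k ω))) =
      ∫ ω in {ω | X.renewal n k ω = t}, g (h ω, X.frame n k ω) ∂P :=
    integral_map hmeas.aemeasurable hG.aestronglyMeasurable
  have h2 : Integrable (fun x : (H × M.Action n) × Frame L => g (x.1.1, x.2))
      ((P.restrict {ω | X.renewal n k ω = t}).map
      (fun ω => ((h ω, X.action n k ω), X.frame n k ω))) :=
    (integrable_map_measure hG.aestronglyMeasurable hmeas.aemeasurable).2 hint
  rw [hm] at h1 h2
  rw [← h1, Measure.integral_compProd h2, integral_map
    (hh'.prodMk (hX.measurable_action n k)).aemeasurable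
    (hG.stronglyMeasurable.integral_kernel_prod_right').aestronglyMeasurable]
  rfl

/-- Transfers almost sure properties of the frame laws to the run; with `exists_frame`, bounds
inside frames become bounds in every slot. -/
theorem IsValid.ae_frame [IsProbabilityMeasure P] (hX : X.IsValid P) (n : Fin N)
    {U : Set (Frame L)} (hU : MeasurableSet U) (h : ∀ a, ∀ᵐ o ∂(M.frameLaw n a), o ∈ U) :
    ∀ᵐ ω ∂P, ∀ k, X.frame n k ω ∈ U := by
  rw [ae_all_iff]
  intro k
  have h1 : ∀ t, ∀ᵐ ω ∂P, X.renewal n k ω = t → X.frame n k ω ∈ U := by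
    intro t
    have := hX.setLIntegral_frame n k t (measurable_one.indicator hU.compl)
    simp only [lintegral_indicator_one hU.compl] at this
    have h0 : ∀ a, M.frameLaw n a Uᶜ = 0 := h
    simp only [h0, lintegral_zero] at this
    have := (lintegral_eq_zero_iff (f := fun ω => Uᶜ.indicator 1 (X.frame n k ω))
      ((measurable_one.indicator hU.compl).comp (hX.measurable_frame n k))).1 this
    rw [Filter.EventuallyEq, ae_restrict_iff' (hX.measurableSet_renewal n k t)] at this
    filter_upwards [this] with ω hω ht
    by_contra hc
    have := hω ht
    simp [Set.indicator, hc] at this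
  filter_upwards [ae_all_iff.2 h1] with ω hω using hω _ rfl

theorem IsValid.exists_frame (hX : X.IsValid P) (n : Fin N) (t : ℕ) (ω : Ω) :
    ∃ k i, i < X.duration n k ω ∧ X.renewal n k ω + i = t := by
  have hmono := hX.strictMono n ω
  have h0 : X.renewal n 0 ω ≤ t := by rw [hX.renewal_zero]; exact Nat.zero_le _
  have hb : ∀ k, X.renewal n k ω ≤ t → k ≤ t := fun k hk => (hmono.id_le k).trans hk
  obtain ⟨k, hk, hk'⟩ : ∃ k, X.renewal n k ω ≤ t ∧ t < X.renewal n (k + 1) ω := by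
    by_contra hc
    push Not at hc
    have : ∀ k, X.renewal n k ω ≤ t := fun k => by
      induction k with
      | zero => exact h0
      | succ k ih => exact hc k ih
    exact absurd (hb _ (this (t + 1))) (by omega)
  refine ⟨k, t - X.renewal n k ω, ?_, by omega⟩
  unfold duration; omega

theorem IsValid.ae_abs_penalty_le [IsProbabilityMeasure P] (hX : X.IsValid P)
    (hb : M.IsBounded Y Z D B) (n : Fin N) : ∀ᵐ ω ∂P, ∀ t, |X.penalty n t ω| ≤ Y := by
  have hU : MeasurableSet {o : Frame L | ∀ i < o.1, |o.2.1 i| ≤ Y} := by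
    simp only [Set.ofPred_forall]
    refine MeasurableSet.iInter fun i => ?_
    have h1 : MeasurableSet {o : Frame L | i < o.1} := measurable_fst measurableSet_Ioi
    have h2 : MeasurableSet {o : Frame L | |o.2.1 i| ≤ Y} :=
      measurableSet_le (by fun_prop) measurable_const
    convert h1.compl.union h2 using 1
    ext o; simp [imp_iff_not_or]
  filter_upwards [hX.ae_frame n hU (hb.penalty n)] with ω hω t
  obtain ⟨k, i, hi, rfl⟩ := hX.exists_frame n t ω
  simpa [frame, hi] using hω k i hi

theorem IsValid.ae_abs_metric_le [IsProbabilityMeasure P] (hX : X.IsValid P)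
    (hb : M.IsBounded Y Z D B) (n : Fin N) : ∀ᵐ ω ∂P, ∀ t l, |X.metric n t ω l| ≤ Z := by
  have hU : MeasurableSet {o : Frame L | ∀ i < o.1, ∀ l, |o.2.2 i l| ≤ Z} := by
    simp only [Set.ofPred_forall]
    refine MeasurableSet.iInter fun i => ?_
    have h1 : MeasurableSet {o : Frame L | i < o.1} := measurable_fst measurableSet_Ioi
    have h2 : MeasurableSet (⋂ l, {o : Frame L | |o.2.2 i l| ≤ Z}) :=
      MeasurableSet.iInter fun l => measurableSet_le (by fun_prop) measurable_const
    convert h1.compl.union h2 using 1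
    ext o; simp [imp_iff_not_or]
  filter_upwards [hX.ae_frame n hU (hb.metric n)] with ω hω t l
  obtain ⟨k, i, hi, rfl⟩ := hX.exists_frame n t ω
  simpa [frame, hi] using hω k i hi l

theorem IsValid.ae_abs_ext_le (hX : X.IsValid P)
    (hb : M.IsBounded Y Z D B) : ∀ᵐ ω ∂P, ∀ t l, |X.ext t ω l| ≤ D := by
  rw [ae_all_iff]
  intro t
  have := hb.ext
  rw [← hX.ext_law t] at this
  exact ae_of_ae_map (hX.measurable_ext t).aemeasurable this

theorem IsValid.integrable_penalty [IsProbabilityMeasure P] (hX : X.IsValid P)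
    (hb : M.IsBounded Y Z D B) (n : Fin N) (t : ℕ) : Integrable (X.penalty n t) P :=
  Integrable.of_bound (hX.measurable_penalty n t).aestronglyMeasurable Y
    (by filter_upwards [hX.ae_abs_penalty_le hb n] with ω hω using hω t)

theorem IsValid.measurable_metric_apply (hX : X.IsValid P) (n : Fin N) (t : ℕ) (l : Fin L) :
    Measurable fun ω => X.metric n t ω l :=
  (measurable_pi_apply l).comp (hX.measurable_metric n t)

theorem IsValid.integrable_metric [IsProbabilityMeasure P] (hX : X.IsValid P)
    (hb : M.IsBounded Y Z D B) (n : Fin N) (t : ℕ) (l : Fin L) :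
    Integrable (fun ω => X.metric n t ω l) P :=
  Integrable.of_bound (hX.measurable_metric_apply n t l).aestronglyMeasurable Z
    (by filter_upwards [hX.ae_abs_metric_le hb n] with ω hω using hω t l)

end SystemRun

/-! ### The frame-based estimate for sums over slots. -/

theorem integrable_natCast_and_integral_le {Ω : Type*} {mΩ : MeasurableSpace Ω} {μ : Measure Ω}
    {f : Ω → ℕ} (hf : Measurable f) {c : ℝ} (hc : 0 ≤ c)
    (h : ∫⁻ ω, (f ω : ℝ≥0∞) ∂μ ≤ ENNReal.ofReal c) :
    Integrable (fun ω => (f ω : ℝ)) μ ∧ ∫ ω, (f ω : ℝ) ∂μ ≤ c := by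
  have hm : AEStronglyMeasurable (fun ω => (f ω : ℝ)) μ :=
    (by fun_prop : Measurable fun ω => (f ω : ℝ)).aestronglyMeasurable
  constructor
  · refine ⟨hm, lt_of_le_of_lt ?_ (lt_of_le_of_lt h ENNReal.ofReal_lt_top)⟩
    exact lintegral_mono fun ω => by rw [Real.enorm_natCast]
  · rw [integral_eq_lintegral_of_nonneg_ae (ae_of_all _ fun ω => Nat.cast_nonneg _) hm]
    simp only [ENNReal.ofReal_natCast]
    exact ENNReal.toReal_le_of_le_ofReal hc h

/-- Summing over slots frame by frame, the last frame being truncated at `T`. -/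
theorem sum_range_le_sum_frames {r : ℕ → ℕ} (hr : StrictMono r) (h0 : r 0 = 0) {T : ℕ}
    {F G : ℕ → ℝ}
    (hlt : ∀ k, r k < T → ∑ i ∈ range (min (r (k + 1) - r k) (T - r k)), F (r k + i) ≤ G k)
    (hge : ∀ k, T ≤ r k → 0 ≤ G k) :
    ∑ t ∈ range T, F t ≤ ∑ k ∈ range T, G k := by
  have key : ∀ k, ∑ t ∈ range (min (r k) T), F t ≤ ∑ j ∈ range k, G j := by
    intro k
    induction k with
    | zero => simp [h0]
    | succ k ih =>
      have hk : r k < r (k + 1) := hr (Nat.lt_succ_self k)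
      rw [Finset.sum_range_succ]
      rcases lt_or_ge (r k) T with h | h
      · have e : min (r (k + 1)) T = r k + min (r (k + 1) - r k) (T - r k) := by omega
        rw [e, Finset.sum_range_add]
        rw [min_eq_left h.le] at ih
        exact add_le_add ih (hlt k h)
      · rw [min_eq_right (h.trans hk.le)]
        rw [min_eq_right h] at ih
        linarith [hge k h]
  have := key T
  -- Renewal times are at least their index, so `T` frames always cover the slots before `T`.
  have hT : T ≤ r T := hr.id_le T
  rwa [min_eq_right hT] at this

namespace SystemRun

variable {N L : ℕ} {M : Model.{u} N L} {Ω : Type v} {X : SystemRun M Ω} {mΩ : MeasurableSpace Ω}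
  {P : Measure Ω} {Y Z D B : ℝ}

/-- Used with `s = T - t` to pay for the part of a frame beyond the horizon, and with `s = 0` for
integrability of the duration. -/
theorem IsValid.residual_bound [IsProbabilityMeasure P] (hX : X.IsValid P)
    (hb : M.IsBounded Y Z D B) (n : Fin N) (k t s : ℕ) :
    IntegrableOn (fun ω => ((X.duration n k ω - s : ℕ) : ℝ)) {ω | X.renewal n k ω = t} P ∧
      ∫ ω in {ω | X.renewal n k ω = t}, ((X.duration n k ω - s : ℕ) : ℝ) ∂P ≤
        B * P.real {ω | X.renewal n k ω = t ∧ s ≤ X.duration n k ω} := by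
  have hB : 0 ≤ B := zero_le_one.trans hb.one_le
  have hd := hX.measurable_duration n k
  refine integrable_natCast_and_integral_le (by fun_prop) (mul_nonneg hB measureReal_nonneg) ?_
  have h1 := hX.setLIntegral_frame n k t
    (g := fun o : Frame L => ((o.1 - s : ℕ) : ℝ≥0∞)) (by fun_prop)
  have hU : MeasurableSet {o : Frame L | s ≤ o.1} := measurable_fst measurableSet_Ici
  have h2 := hX.setLIntegral_frame n k t (measurable_one.indicator hU)
  simp only [lintegral_indicator_one hU] at h2
  have h3 : ∫⁻ ω in {ω | X.renewal n k ω = t},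
      {o : Frame L | s ≤ o.1}.indicator 1 (X.frame n k ω) ∂P =
      P {ω | X.renewal n k ω = t ∧ s ≤ X.duration n k ω} := by
    have : MeasurableSet {ω | s ≤ X.duration n k ω} := hd measurableSet_Ici
    rw [show {ω | X.renewal n k ω = t ∧ s ≤ X.duration n k ω} =
      {ω | s ≤ X.duration n k ω} ∩ {ω | X.renewal n k ω = t} by ext; simp [and_comm],
      ← Measure.restrict_apply this, ← lintegral_indicator_one this]
    rfl
  calc ∫⁻ ω in {ω | X.renewal n k ω = t}, ((X.duration n k ω - s : ℕ) : ℝ≥0∞) ∂P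
      = ∫⁻ ω in {ω | X.renewal n k ω = t},
          ∫⁻ o, ((o.1 - s : ℕ) : ℝ≥0∞) ∂(M.frameLaw n (X.action n k ω)) ∂P := h1
    _ ≤ ∫⁻ ω in {ω | X.renewal n k ω = t},
          ENNReal.ofReal B * M.frameLaw n (X.action n k ω) {o | s ≤ o.1} ∂P :=
        lintegral_mono fun ω => hb.lintegral_residual_le n _ s
    _ = ENNReal.ofReal B * P {ω | X.renewal n k ω = t ∧ s ≤ X.duration n k ω} := by
        rw [lintegral_const_mul' _ _ ENNReal.ofReal_ne_top, ← h2, h3]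
    _ = _ := by rw [ENNReal.ofReal_mul hB, ofReal_measureReal]

theorem IsValid.duration_sq_bound [IsProbabilityMeasure P] (hX : X.IsValid P)
    (hb : M.IsBounded Y Z D B) (n : Fin N) (k t : ℕ) :
    IntegrableOn (fun ω => (X.duration n k ω : ℝ) ^ 2) {ω | X.renewal n k ω = t} P ∧
      ∫ ω in {ω | X.renewal n k ω = t}, (X.duration n k ω : ℝ) ^ 2 ∂P ≤
        B * P.real {ω | X.renewal n k ω = t} := by
  have hB : 0 ≤ B := zero_le_one.trans hb.one_le
  have hd := hX.measurable_duration n k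
  have h := integrable_natCast_and_integral_le (μ := P.restrict {ω | X.renewal n k ω = t})
    (f := fun ω => X.duration n k ω ^ 2) (c := B * P.real {ω | X.renewal n k ω = t})
    (by fun_prop) (mul_nonneg hB measureReal_nonneg) ?_
  · simp only [Nat.cast_pow] at h
    exact h
  have h1 := hX.setLIntegral_frame n k t
    (g := fun o : Frame L => (o.1 : ℝ≥0∞) ^ 2) (by fun_prop)
  simp only [Nat.cast_pow]
  calc ∫⁻ ω in {ω | X.renewal n k ω = t}, (X.duration n k ω : ℝ≥0∞) ^ 2 ∂P
      = ∫⁻ ω in {ω | X.renewal n k ω = t},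
          ∫⁻ o, (o.1 : ℝ≥0∞) ^ 2 ∂(M.frameLaw n (X.action n k ω)) ∂P := h1
    _ ≤ ∫⁻ _ω in {ω | X.renewal n k ω = t}, ENNReal.ofReal B ∂P :=
        lintegral_mono fun ω => hb.lintegral_duration_sq_le n _
    _ = _ := by
        rw [lintegral_const, Measure.restrict_apply_univ, ENNReal.ofReal_mul hB,
          ofReal_measureReal]

theorem IsValid.integrableOn_duration [IsProbabilityMeasure P] (hX : X.IsValid P)
    (hb : M.IsBounded Y Z D B) (n : Fin N) (k t : ℕ) :
    IntegrableOn (fun ω => (X.duration n k ω : ℝ)) {ω | X.renewal n k ω = t} P := by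
  simpa using (hX.residual_bound hb n k t 0).1

theorem frameCost_frame (n : Fin N) (k : ℕ) (ω : Ω) (V : ℝ) (q : Fin L → ℝ) :
    frameCost V q (X.frame n k ω) = ∑ i ∈ range (X.duration n k ω),
      (V * X.penalty n (X.renewal n k ω + i) ω +
        ∑ l, q l * X.metric n (X.renewal n k ω + i) ω l) := by
  refine Finset.sum_congr rfl fun i hi => ?_
  have : i < X.duration n k ω := Finset.mem_range.1 hi
  simp [frame, this]

/-- If the ratio of the decision is at most `b` at the start of a frame, the conditional
expectation of the excess cost of the frame is nonpositive. -/
theorem IsValid.setIntegral_excess_le [IsProbabilityMeasure P] (hX : X.IsValid P)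
    (hb : M.IsBounded Y Z D B) (n : Fin N) (k t : ℕ) {V R R' : ℝ} {W : Ω → Fin L → ℝ} {b : Ω → ℝ}
    (hW : Measurable[X.history t] W) (hbm : Measurable[X.history t] b)
    (hWR : ∀ᵐ ω ∂P, ∀ l, |W ω l| ≤ R) (hbR : ∀ᵐ ω ∂P, |b ω| ≤ R')
    (hratio : ∀ᵐ ω ∂P, X.renewal n k ω = t →
      M.dppRatio V (W ω) n (X.action n k ω) ≤ b ω) :
    IntegrableOn (fun ω => frameCost V (W ω) (X.frame n k ω) - b ω * X.duration n k ω)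
        {ω | X.renewal n k ω = t} P ∧
      ∫ ω in {ω | X.renewal n k ω = t},
        (frameCost V (W ω) (X.frame n k ω) - b ω * X.duration n k ω) ∂P ≤ 0 := by
  have hA := hX.measurableSet_renewal n k t
  have hh : Measurable[X.history t] fun ω => (W ω, b ω) := Measurable.prodMk hW hbm
  have hg : Measurable fun x : ((Fin L → ℝ) × ℝ) × Frame L =>
      frameCost V x.1.1 x.2 - x.1.2 * (x.2.1 : ℝ) :=
    ((measurable_frameCost V).comp (by fun_prop :
      Measurable fun x : ((Fin L → ℝ) × ℝ) × Frame L => (x.1.1, x.2))).sub (by fun_prop)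
  have hint : IntegrableOn (fun ω => frameCost V (W ω) (X.frame n k ω) - b ω * X.duration n k ω)
      {ω | X.renewal n k ω = t} P := by
    refine Integrable.mono' ((hX.integrableOn_duration hb n k t).const_mul
      (|V| * Y + L * R * Z + R')) (hg.comp (((hh.mono (hX.history_le t) le_rfl)).prodMk
        (hX.measurable_frame n k))).aestronglyMeasurable (ae_restrict_of_ae ?_)
    filter_upwards [hX.ae_abs_penalty_le hb n, hX.ae_abs_metric_le hb n, hWR, hbR]
      with ω h1 h2 h3 h4
    rw [Real.norm_eq_abs, add_mul]
    refine (abs_sub _ _).trans (add_le_add ?_ ?_)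
    · refine abs_frameCost_le (o := X.frame n k ω) (fun i hi => ?_) (fun i hi l => ?_) h3
      · have : i < X.duration n k ω := hi
        simpa [frame, this] using h1 _
      · have : i < X.duration n k ω := hi
        simpa [frame, this] using h2 _ l
    · rw [abs_mul, Nat.abs_cast]; gcongr
  refine ⟨hint, ?_⟩
  have h := hX.setIntegral_frame n k t hh hg hint
  refine (le_of_eq h).trans ?_
  refine integral_nonpos_of_ae ?_
  rw [Filter.EventuallyLE, ae_restrict_iff' hA]
  filter_upwards [hratio, hWR] with ω h1 h2 hω
  set a := X.action n k ω
  have ht : 0 < M.tHat n a := lt_of_lt_of_le one_pos (hb.one_le_tHat n a)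
  have hc : Integrable (frameCost V (W ω)) (M.frameLaw n a) := by
    refine hb.integrable_of_abs_le n a (measurable_frameCost_right V _)
      (K := |V| * Y + L * R * Z) ?_
    filter_upwards [hb.penalty n a, hb.metric n a] with o hy hz
    exact abs_frameCost_le hy hz h2
  have h3 : (∫ o, frameCost V (W ω) o ∂(M.frameLaw n a)) / M.tHat n a ≤ b ω := h1 hω
  rw [div_le_iff₀ ht] at h3
  show ∫ o, (frameCost V (W ω) o - b ω * (o.1 : ℝ)) ∂(M.frameLaw n a) ≤ 0
  rw [integral_sub hc ((hb.integrable_duration n a).const_mul _), integral_const_mul]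
  exact sub_nonpos.2 h3

theorem IsValid.sum_measureReal_renewal_le [IsProbabilityMeasure P] (hX : X.IsValid P)
    (n : Fin N) (T : ℕ) :
    ∑ k ∈ range T, ∑ t ∈ range T, P.real {ω | X.renewal n k ω = t} ≤ T := by
  calc ∑ k ∈ range T, ∑ t ∈ range T, P.real {ω | X.renewal n k ω = t}
      ≤ ∑ _k ∈ range T, (1 : ℝ) := by
        refine Finset.sum_le_sum fun k _ => ?_
        have := sum_measureReal_le_measureReal_univ (μ := P) (s := range T)
          (t := fun t => {ω | X.renewal n k ω = t})
          (fun t _ => hX.measurableSet_renewal n k t) ?_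
        · simpa using this
        · intro t _ t' _ htt
          refine Set.disjoint_left.2 fun ω h h' => htt ?_
          exact (show X.renewal n k ω = t from h).symm.trans h'
    _ = T := by simp

/-- At most one frame contains the slot before `T`. -/
theorem IsValid.sum_measureReal_straddle_le [IsProbabilityMeasure P] (hX : X.IsValid P)
    (n : Fin N) (T : ℕ) :
    ∑ k ∈ range T, ∑ t ∈ range T,
      P.real {ω | X.renewal n k ω = t ∧ T - t ≤ X.duration n k ω} ≤ 1 := by
  rw [← Finset.sum_product']
  have := sum_measureReal_le_measureReal_univ (μ := P) (s := range T ×ˢ range T)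
    (t := fun x => {ω | X.renewal n x.1 ω = x.2 ∧ T - x.2 ≤ X.duration n x.1 ω})
    (fun x _ => (hX.measurableSet_renewal n x.1 x.2).inter
      (hX.measurable_duration n x.1 measurableSet_Ici)) ?_
  · simpa using this
  · rintro ⟨k, t⟩ hx ⟨k', t'⟩ hx' hne
    refine Set.disjoint_left.2 ?_
    rintro ω ⟨h1, h2⟩ ⟨h1', h2'⟩
    simp only [Finset.coe_product, Set.mem_prod, Finset.mem_coe, Finset.mem_range] at hx hx'
    -- If both events held with `k < k'`, frame `k` would reach `T` while the later frame starts
    -- before `T`.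
    dsimp only at h1 h2 h1' h2'
    have e := hX.renewal_succ n k ω
    have e' := hX.renewal_succ n k' ω
    have hm := hX.strictMono n ω
    rcases lt_trichotomy k k' with h | h | h
    · have : X.renewal n (k + 1) ω ≤ X.renewal n k' ω := hm.monotone h
      omega
    · subst h; exact hne (by rw [← h1, ← h1'])
    · have : X.renewal n (k' + 1) ω ≤ X.renewal n k ω := hm.monotone h
      omega

/-- The frame-based estimate: a bound on the ratios at the starts of the frames gives a bound on
the expected slot costs, up to the last frame and a drift `K i` inside the frames. -/
theorem IsValid.sum_integral_le [IsProbabilityMeasure P] (hX : X.IsValid P)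
    (hb : M.IsBounded Y Z D B) (hY : 0 ≤ Y) (hZ : 0 ≤ Z) (n : Fin N) (T : ℕ)
    {V R R' K : ℝ} (hR : 0 ≤ R) (hR' : 0 ≤ R') (hK : 0 ≤ K)
    {W : ℕ → Ω → Fin L → ℝ} {b : ℕ → Ω → ℝ}
    (hW : ∀ t, Measurable[X.history t] (W t)) (hbm : ∀ t, Measurable[X.history t] (b t))
    (hWR : ∀ t < T, ∀ᵐ ω ∂P, ∀ l, |W t ω l| ≤ R) (hbR : ∀ t < T, ∀ᵐ ω ∂P, |b t ω| ≤ R')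
    (hratio : ∀ k, ∀ t < T, ∀ᵐ ω ∂P, X.renewal n k ω = t →
      M.dppRatio V (W t ω) n (X.action n k ω) ≤ b t ω)
    {F : ℕ → Ω → ℝ} (hF : ∀ t < T, Integrable (F t) P)
    (hFle : ∀ᵐ ω ∂P, ∀ t i, t + i < T →
      F (t + i) ω ≤ V * X.penalty n (t + i) ω + ∑ l, W t ω l * X.metric n (t + i) ω l -
        b t ω + K * i) :
    ∑ t ∈ range T, ∫ ω, F t ω ∂P ≤ (|V| * Y + L * R * Z + R') * B + K * B * T := by
  set K₁ : ℝ := |V| * Y + L * R * Z + R' with hK₁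
  have hK₁0 : 0 ≤ K₁ := by positivity
  -- The whole-frame excess has nonpositive mean. The second term restores the slots beyond `T`,
  -- each of excess at least `-K₁`; the third absorbs the drift, at most `K d` in each of at most
  -- `d` slots.
  let S : ℕ → ℕ → Ω → ℝ := fun k t ω =>
    (frameCost V (W t ω) (X.frame n k ω) - b t ω * X.duration n k ω) +
      K₁ * ((X.duration n k ω - (T - t) : ℕ) : ℝ) + K * (X.duration n k ω : ℝ) ^ 2
  let A : ℕ → ℕ → Set Ω := fun k t => {ω | X.renewal n k ω = t}
  have hA : ∀ k t, MeasurableSet (A k t) := hX.measurableSet_renewal n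
  have hS : ∀ k, ∀ t < T, IntegrableOn (S k t) (A k t) P ∧ ∫ ω in A k t, S k t ω ∂P ≤
      K₁ * B * P.real {ω | X.renewal n k ω = t ∧ T - t ≤ X.duration n k ω} +
        K * B * P.real {ω | X.renewal n k ω = t} := by
    intro k t ht
    obtain ⟨i1, e1⟩ := hX.setIntegral_excess_le hb n k t (hW t) (hbm t) (hWR t ht) (hbR t ht)
      (hratio k t ht)
    obtain ⟨i2, e2⟩ := hX.residual_bound hb n k t (T - t)
    obtain ⟨i3, e3⟩ := hX.duration_sq_bound hb n k t
    refine ⟨(i1.add (i2.const_mul K₁)).add (i3.const_mul K), ?_⟩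
    have : ∫ ω in A k t, S k t ω ∂P = _ :=
      (integral_add (i1.add (i2.const_mul K₁)) (i3.const_mul K)).trans
        (congrArg₂ _ (integral_add i1 (i2.const_mul K₁)) rfl)
    rw [this, integral_const_mul, integral_const_mul]
    nlinarith [mul_le_mul_of_nonneg_left e2 hK₁0, mul_le_mul_of_nonneg_left e3 hK]
  have hSi : ∀ k, ∀ t ∈ range T, Integrable ((A k t).indicator (S k t)) P := fun k t ht =>
    (integrable_indicator_iff (hA k t)).2 (hS k t (Finset.mem_range.1 ht)).1
  have hpt : ∀ᵐ ω ∂P, ∑ t ∈ range T, F t ω ≤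
      ∑ k ∈ range T, ∑ t ∈ range T, (A k t).indicator (S k t) ω := by
    filter_upwards [hFle, hX.ae_abs_penalty_le hb n, hX.ae_abs_metric_le hb n,
      ae_all_iff.2 fun t => eventually_imp_distrib_left.2 (hWR t),
      ae_all_iff.2 fun t => eventually_imp_distrib_left.2 (hbR t)] with ω hω h1 h2 h3 h4
    refine sum_range_le_sum_frames (hX.strictMono n ω) (hX.renewal_zero n ω) ?_ ?_
    · intro k hk
      set t := X.renewal n k ω with ht
      have hsum : ∑ s ∈ range T, (A k s).indicator (S k s) ω = S k t ω := by
        rw [Finset.sum_eq_single_of_mem t (Finset.mem_range.2 hk)]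
        · exact Set.indicator_of_mem (show ω ∈ A k t from rfl) _
        · intro s _ hs
          exact Set.indicator_of_notMem (fun h : ω ∈ A k s => hs (Eq.symm h)) _
      rw [hsum]
      have hd : X.renewal n (k + 1) ω - t = X.duration n k ω := rfl
      rw [hd]
      set d := X.duration n k ω
      set m := min d (T - t) with hm
      let c : ℕ → ℝ := fun i => V * X.penalty n (t + i) ω +
        ∑ l, W t ω l * X.metric n (t + i) ω l - b t ω
      have hcost : frameCost V (W t ω) (X.frame n k ω) - b t ω * d = ∑ i ∈ range d, c i := by
        rw [frameCost_frame, Finset.sum_sub_distrib]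
        simp [mul_comm, d, t]
      have hsplit : ∑ i ∈ range d, c i = ∑ i ∈ range m, c i + ∑ i ∈ range (d - (T - t)),
          c (m + i) := by
        rw [← Finset.sum_range_add]; congr 2; omega
      have hover : -(K₁ * ((d - (T - t) : ℕ) : ℝ)) ≤ ∑ i ∈ range (d - (T - t)), c (m + i) := by
        have : ∀ i, -K₁ ≤ c i := fun i => by
          have a1 := (abs_le.1 (abs_slotCost_le (V := V) (h1 (t + i)) (h2 (t + i)) (h3 t hk))).1
          have a2 := (abs_le.1 (h4 t hk)).2
          simp only [c, hK₁]; linarith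
        calc -(K₁ * ((d - (T - t) : ℕ) : ℝ)) = ∑ _i ∈ range (d - (T - t)), (-K₁) := by
              simp [mul_comm]
          _ ≤ _ := Finset.sum_le_sum fun i _ => this _
      have hin : ∑ i ∈ range m, F (t + i) ω ≤ ∑ i ∈ range m, c i + K * (d : ℝ) ^ 2 := by
        calc ∑ i ∈ range m, F (t + i) ω ≤ ∑ i ∈ range m, (c i + K * d) := by
              refine Finset.sum_le_sum fun i hi => ?_
              have hi' := Finset.mem_range.1 hi
              refine (hω t i (by omega)).trans ?_
              have : (i : ℝ) ≤ d := by exact_mod_cast (by omega : i ≤ d)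
              have := mul_le_mul_of_nonneg_left this hK
              simp only [c]; linarith
          _ = ∑ i ∈ range m, c i + m * (K * d) := by
              rw [Finset.sum_add_distrib]; simp
          _ ≤ _ := by
              have : (m : ℝ) ≤ d := by exact_mod_cast min_le_left _ _
              have := mul_le_mul_of_nonneg_right this (by positivity : (0 : ℝ) ≤ K * d)
              nlinarith
      show _ ≤ (frameCost V (W t ω) (X.frame n k ω) - b t ω * d) +
        K₁ * ((d - (T - t) : ℕ) : ℝ) + K * (d : ℝ) ^ 2
      rw [hcost, hsplit]
      linarith
    · intro k hk
      refine Finset.sum_nonneg fun s hs => le_of_eq (Eq.symm ?_)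
      refine Set.indicator_of_notMem (s := A k s) (fun h : X.renewal n k ω = s => ?_) (S k s)
      have := Finset.mem_range.1 hs
      omega
  calc ∑ t ∈ range T, ∫ ω, F t ω ∂P = ∫ ω, ∑ t ∈ range T, F t ω ∂P :=
        (integral_finsetSum _ fun t ht => hF t (Finset.mem_range.1 ht)).symm
    _ ≤ ∫ ω, ∑ k ∈ range T, ∑ t ∈ range T, (A k t).indicator (S k t) ω ∂P :=
        integral_mono_ae (integrable_finsetSum _ fun t ht => hF t (Finset.mem_range.1 ht))
          (integrable_finsetSum _ fun k _ => integrable_finsetSum _ fun t ht => hSi k t ht) hpt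
    _ = ∑ k ∈ range T, ∑ t ∈ range T, ∫ ω in A k t, S k t ω ∂P := by
        rw [integral_finsetSum _ fun k _ => integrable_finsetSum _ fun t ht => hSi k t ht]
        refine Finset.sum_congr rfl fun k _ => ?_
        rw [integral_finsetSum _ fun t ht => hSi k t ht]
        exact Finset.sum_congr rfl fun t _ => integral_indicator (hA k t)
    _ ≤ ∑ k ∈ range T, ∑ t ∈ range T,
          (K₁ * B * P.real {ω | X.renewal n k ω = t ∧ T - t ≤ X.duration n k ω} +
            K * B * P.real {ω | X.renewal n k ω = t}) :=
        Finset.sum_le_sum fun k _ => Finset.sum_le_sum fun t ht =>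
          (hS k t (Finset.mem_range.1 ht)).2
    _ = K₁ * B * (∑ k ∈ range T, ∑ t ∈ range T,
          P.real {ω | X.renewal n k ω = t ∧ T - t ≤ X.duration n k ω}) +
        K * B * ∑ k ∈ range T, ∑ t ∈ range T, P.real {ω | X.renewal n k ω = t} := by
        simp only [Finset.sum_add_distrib, Finset.mul_sum]
    _ ≤ K₁ * B * 1 + K * B * T := by
        have hB : 0 ≤ B := zero_le_one.trans hb.one_le
        have := hX.sum_measureReal_straddle_le n T
        have := hX.sum_measureReal_renewal_le n T
        gcongr
    _ = _ := by rw [mul_one]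

end SystemRun

/-! ### Lower bounds valid for every run, and weak duality. -/

namespace SystemRun

variable {N L : ℕ} {M : Model.{u} N L} {Ω : Type v} {X : SystemRun M Ω} {mΩ : MeasurableSpace Ω}
  {P : Measure Ω} {Y Z D B : ℝ}

theorem nonempty_action (X : SystemRun M Ω) (P : Measure Ω) [IsProbabilityMeasure P] (n : Fin N) :
    Nonempty (M.Action n) :=
  (nonempty_of_isProbabilityMeasure P).map (X.action n 0)

theorem mul_avgPenalty (T : ℕ) (hT : 0 < T) :
    (T : ℝ) * X.avgPenalty P T = ∑ t ∈ range T, ∑ n, ∫ ω, X.penalty n t ω ∂P := by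
  have : (T : ℝ) ≠ 0 := by positivity
  unfold avgPenalty; field_simp

theorem mul_avgMetric (l : Fin L) (T : ℕ) (hT : 0 < T) :
    (T : ℝ) * X.avgMetric P l T = ∑ t ∈ range T, ∑ n, ∫ ω, X.metric n t ω l ∂P := by
  have : (T : ℝ) ≠ 0 := by positivity
  unfold avgMetric; field_simp

/-- Any run pays at least the optimal ratio per slot, up to a constant. -/
theorem IsValid.mul_bestRatio_le [IsProbabilityMeasure P] (hX : X.IsValid P)
    (hb : M.IsBounded Y Z D B) (hY : 0 ≤ Y) (hZ : 0 ≤ Z) (n : Fin N) (T : ℕ) (V : ℝ) {R : ℝ}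
    (hR : 0 ≤ R) {q : Fin L → ℝ} (hq : ∀ l, |q l| ≤ R) :
    T * M.bestRatio V n q ≤ ∑ t ∈ range T,
      (V * ∫ ω, X.penalty n t ω ∂P + ∑ l, q l * ∫ ω, X.metric n t ω l ∂P) +
        2 * (|V| * Y + L * R * Z) * B := by
  have := X.nonempty_action P n
  set m := M.bestRatio V n q with hm
  have i1 := fun t => (hX.integrable_penalty hb n t).const_mul (-V)
  have i2 := fun t l => (hX.integrable_metric hb n t l).const_mul (-q l)
  have i3 := fun t => integrable_finsetSum univ fun l _ => i2 t l
  -- With negated weights, every decision has ratio at most `-m`, so any run qualifies; the weights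
  -- are constant, hence there is no drift and `K = 0`.
  have key := hX.sum_integral_le hb hY hZ n T (V := -V) (R := R) (R' := |V| * Y + L * R * Z)
    (K := 0) hR (by positivity) le_rfl (W := fun _ _ => -q) (b := fun _ _ => -m)
    (fun _ => measurable_const) (fun _ => measurable_const)
    (fun _ _ => ae_of_all _ fun _ l => by simpa using hq l)
    (fun _ _ => ae_of_all _ fun _ => by rw [abs_neg]; exact hb.abs_bestRatio_le hq n)
    (fun k _ _ => ae_of_all _ fun ω _ => by
      have h1 := hb.bestRatio_le V n q (X.action n k ω)
      rw [hb.dppRatio_eq] at h1 ⊢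
      simp only [Pi.neg_apply, neg_mul, Finset.sum_neg_distrib]
      linarith)
    (F := fun t ω => -V * X.penalty n t ω + ∑ l, -q l * X.metric n t ω l + m)
    (fun t _ => ((i1 t).add (i3 t)).add (integrable_const _))
    (ae_of_all _ fun ω t i _ => by simp)
  have hint : ∀ t, ∫ ω, (-V * X.penalty n t ω + ∑ l, -q l * X.metric n t ω l + m) ∂P =
      m - (V * ∫ ω, X.penalty n t ω ∂P + ∑ l, q l * ∫ ω, X.metric n t ω l ∂P) := by
    intro t
    have i4 : Integrable (fun ω => -V * X.penalty n t ω + ∑ l, -q l * X.metric n t ω l) P :=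
      (i1 t).add (i3 t)
    rw [integral_add i4 (integrable_const _), integral_add (i1 t) (i3 t),
      integral_finsetSum _ fun l _ => i2 t l]
    simp only [integral_const_mul, integral_const, probReal_univ, one_smul]
    simp only [neg_mul, Finset.sum_neg_distrib]
    ring
  simp only [hint, Finset.sum_sub_distrib, Finset.sum_const, Finset.card_range, nsmul_eq_mul,
    abs_neg] at key
  linarith

theorem IsValid.mul_sum_bestRatio_le [IsProbabilityMeasure P] (hX : X.IsValid P)
    (hb : M.IsBounded Y Z D B) (hY : 0 ≤ Y) (hZ : 0 ≤ Z) {T : ℕ} (hT : 0 < T) (V : ℝ) {R : ℝ}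
    (hR : 0 ≤ R) {q : Fin L → ℝ} (hq : ∀ l, |q l| ≤ R) :
    T * ∑ n, M.bestRatio V n q ≤
      T * (V * X.avgPenalty P T + ∑ l, q l * X.avgMetric P l T) +
        N * (2 * (|V| * Y + L * R * Z) * B) := by
  have h := Finset.sum_le_sum fun n (_ : n ∈ univ) => hX.mul_bestRatio_le hb hY hZ n T V hR hq
  rw [← Finset.mul_sum] at h
  refine h.trans (le_of_eq ?_)
  rw [Finset.sum_add_distrib]
  congr 1
  · have e1 : (T : ℝ) * (V * X.avgPenalty P T + ∑ l, q l * X.avgMetric P l T) =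
        V * (T * X.avgPenalty P T) + ∑ l, q l * (T * X.avgMetric P l T) := by
      rw [mul_add, Finset.mul_sum]; congr 1
      · ring
      · exact Finset.sum_congr rfl fun l _ => by ring
    rw [e1, mul_avgPenalty T hT]
    simp only [mul_avgMetric _ T hT]
    rw [Finset.sum_comm]
    simp only [Finset.sum_add_distrib, Finset.mul_sum]
    congr 1
    rw [Finset.sum_comm (s := univ (α := Fin L))]
    refine Finset.sum_congr rfl fun t _ => Finset.sum_comm
  · simp

theorem abs_average_le {a : ℕ → Fin N → ℝ} {c : ℝ} (hc : 0 ≤ c) (ha : ∀ t n, |a t n| ≤ c)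
    (T : ℕ) : |(1 / (T : ℝ)) * ∑ t ∈ range T, ∑ n, a t n| ≤ N * c := by
  have h1 : |∑ t ∈ range T, ∑ n, a t n| ≤ T * (N * c) := by
    refine (Finset.abs_sum_le_sum_abs _ _).trans ?_
    calc _ ≤ ∑ _t ∈ range T, (N * c) := Finset.sum_le_sum fun t _ => by
          refine (Finset.abs_sum_le_sum_abs _ _).trans ?_
          refine (Finset.sum_le_sum fun n _ => ha t n).trans ?_
          simp
      _ = _ := by simp
  rw [abs_mul, abs_of_nonneg (by positivity : (0 : ℝ) ≤ 1 / T), one_div]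
  -- For `T = 0` the average is `0` because `1 / 0 = 0`; the bound must hold for all `T` to make the
  -- limsup well behaved.
  rcases Nat.eq_zero_or_pos T with rfl | hT
  · simp; positivity
  · have : (0 : ℝ) < T := by exact_mod_cast hT
    rwa [inv_mul_le_iff₀ this]

theorem IsValid.abs_avgPenalty_le [IsProbabilityMeasure P] (hX : X.IsValid P)
    (hb : M.IsBounded Y Z D B) (hY : 0 ≤ Y) (T : ℕ) : |X.avgPenalty P T| ≤ N * Y := by
  refine abs_average_le hY (fun t n => ?_) T
  simpa using norm_integral_le_of_norm_le_const (μ := P) (C := Y) (f := X.penalty n t)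
    (by filter_upwards [hX.ae_abs_penalty_le hb n] with ω hω using hω t)

theorem IsValid.abs_avgMetric_le [IsProbabilityMeasure P] (hX : X.IsValid P)
    (hb : M.IsBounded Y Z D B) (hZ : 0 ≤ Z) (l : Fin L) (T : ℕ) :
    |X.avgMetric P l T| ≤ N * Z := by
  refine abs_average_le hZ (fun t n => ?_) T
  simpa using norm_integral_le_of_norm_le_const (μ := P) (C := Z)
    (f := fun ω => X.metric n t ω l)
    (by filter_upwards [hX.ae_abs_metric_le hb n] with ω hω using hω t l)

/-- Boundedness is essential here: a real `limsup` carries no information about a sequence unbounded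
above. -/
theorem eventually_lt_of_limsup_le {a : ℕ → ℝ} {c C δ : ℝ} (hC : ∀ T, |a T| ≤ C)
    (h : limsup a atTop ≤ c) (hδ : 0 < δ) : ∀ᶠ T in atTop, a T < c + δ :=
  eventually_lt_of_limsup_lt (lt_of_le_of_lt h (lt_add_of_pos_right c hδ))
    (isBoundedUnder_of ⟨C, fun T => (abs_le.1 (hC T)).2⟩)

end SystemRun

namespace Model

variable {N L : ℕ} {M : Model.{u} N L} {Y Z D B : ℝ}

/-- Weak duality: the optimal ratios bound the optimal value from below. -/
theorem IsFeasible.sum_bestRatio_le (hf : M.IsFeasible) (hb : M.IsBounded Y Z D B) (hY : 0 ≤ Y)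
    (hZ : 0 ≤ Z) {V : ℝ} (hV : 0 < V) {q : Fin L → ℝ} (hq : ∀ l, 0 ≤ q l) :
    ∑ n, M.bestRatio V n q ≤ V * M.optValue + ∑ l, q l * M.dMean l := by
  suffices h : ∀ c ∈ M.feasibleValues,
      ∑ n, M.bestRatio V n q ≤ V * c + ∑ l, q l * M.dMean l by
    have : (∑ n, M.bestRatio V n q - ∑ l, q l * M.dMean l) / V ≤ M.optValue :=
      -- Feasibility makes the infimum a genuine one, so a lower bound on all feasible values passes
      -- to it.
      le_csInf hf fun c hc => by rw [div_le_iff₀ hV]; linarith [h c hc]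
    rw [div_le_iff₀ hV] at this
    linarith
  rintro c ⟨Ω, mΩ, P, X, hP, hX, hXc, rfl⟩
  set c := limsup (X.avgPenalty P) atTop
  set K := N * (2 * (|V| * Y + L * ‖q‖ * Z) * B)
  refine le_of_forall_pos_le_add fun η hη => ?_
  have hqs : 0 ≤ ∑ l, q l := Finset.sum_nonneg fun l _ => hq l
  -- A loss of `δ` occurs in the penalty (weight `V`), in each constraint (weight `q l`) and in the
  -- error `K / T` (weight one); together they amount to `η`.
  set δ := η / (V + ∑ l, q l + 1) with hδ
  have hδ0 : 0 < δ := by positivity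
  have hlim : ∀ᶠ T : ℕ in atTop, K / T < δ :=
    (tendsto_const_div_atTop_nhds_zero_nat K).eventually_lt_const hδ0
  obtain ⟨T, hT1, hT2, hT3, hT4⟩ := ((SystemRun.eventually_lt_of_limsup_le
    (hX.abs_avgPenalty_le hb hY) (le_refl c) hδ0).and
    ((eventually_all.2 fun l => SystemRun.eventually_lt_of_limsup_le
      (hX.abs_avgMetric_le hb hZ l) (hXc l) hδ0).and
      (hlim.and (eventually_gt_atTop 0)))).exists
  have hTpos : (0 : ℝ) < T := by exact_mod_cast hT4
  have h := hX.mul_sum_bestRatio_le hb hY hZ hT4 V (norm_nonneg q) (norm_le_pi_norm q)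
  rw [div_lt_iff₀ hTpos] at hT3
  have h2 : ∑ n, M.bestRatio V n q ≤ V * X.avgPenalty P T + ∑ l, q l * X.avgMetric P l T + δ := by
    refine le_of_mul_le_mul_left (h.trans ?_) hTpos
    rw [mul_add (T : ℝ) _ δ]
    linarith
  have h3 : ∑ l, q l * X.avgMetric P l T ≤ ∑ l, q l * (M.dMean l + δ) :=
    Finset.sum_le_sum fun l _ => mul_le_mul_of_nonneg_left (hT2 l).le (hq l)
  simp only [mul_add, Finset.sum_add_distrib, ← Finset.sum_mul] at h3
  have h4 : V * X.avgPenalty P T ≤ V * (c + δ) := mul_le_mul_of_nonneg_left hT1.le hV.le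
  have h5 : δ * (V + ∑ l, q l + 1) = η := div_mul_cancel₀ _ (by positivity)
  linarith

end Model

/-! ### Virtual queues and the drift-plus-penalty bound. -/

namespace SystemRun

variable {N L : ℕ} {M : Model.{u} N L} {Ω : Type v} {X : SystemRun M Ω} {mΩ : MeasurableSpace Ω}
  {P : Measure Ω} {Y Z D B : ℝ}

theorem queue_nonneg (t : ℕ) (ω : Ω) (l : Fin L) : 0 ≤ X.queue t ω l := by
  cases t with
  | zero => exact le_rfl
  | succ t => exact le_max_right _ _

theorem IsValid.ae_abs_arrival_le [IsProbabilityMeasure P] (hX : X.IsValid P)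
    (hb : M.IsBounded Y Z D B) :
    ∀ᵐ ω ∂P, ∀ t l, |∑ n, X.metric n t ω l - X.ext t ω l| ≤ N * Z + D := by
  filter_upwards [ae_all_iff.2 fun n => hX.ae_abs_metric_le hb n, hX.ae_abs_ext_le hb]
    with ω h1 h2 t l
  refine (abs_sub _ _).trans (add_le_add ?_ (h2 t l))
  refine (Finset.abs_sum_le_sum_abs _ _).trans ?_
  exact (Finset.sum_le_sum fun n _ => h1 n t l).trans (by simp)

/-- Taking the positive part does not increase the distance to the nonnegative previous value, so
one step moves the queue by at most the net arrival. -/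
theorem IsValid.ae_abs_queue_sub_le [IsProbabilityMeasure P] (hX : X.IsValid P)
    (hb : M.IsBounded Y Z D B) :
    ∀ᵐ ω ∂P, ∀ t i l, |X.queue (t + i) ω l - X.queue t ω l| ≤ (N * Z + D) * i := by
  filter_upwards [hX.ae_abs_arrival_le hb] with ω hω t i l
  induction i with
  | zero => simp
  | succ i ih =>
    have h0 := queue_nonneg (X := X) (t + i) ω l
    have h1 := hω (t + i) l
    have h2 : |X.queue (t + i + 1) ω l - X.queue (t + i) ω l| ≤ N * Z + D := by
      refine le_trans ?_ h1
      have e : X.queue (t + i + 1) ω l =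
        max (X.queue (t + i) ω l + ∑ n, X.metric n (t + i) ω l - X.ext (t + i) ω l) 0 := rfl
      rw [e]
      grind
    have h3 := abs_sub_le (X.queue (t + i + 1) ω l) (X.queue (t + i) ω l) (X.queue t ω l)
    rw [← add_assoc]
    push_cast
    linarith

theorem IsValid.ae_abs_queue_le [IsProbabilityMeasure P] (hX : X.IsValid P)
    (hb : M.IsBounded Y Z D B) :
    ∀ᵐ ω ∂P, ∀ t l, |X.queue t ω l| ≤ (N * Z + D) * t := by
  filter_upwards [hX.ae_abs_queue_sub_le hb] with ω hω t l
  simpa [queue] using hω 0 t l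

theorem IsValid.measurable_queue (hX : X.IsValid P) (t : ℕ) : Measurable (X.queue t) :=
  (measurable_history_queue t).mono (hX.history_le t) le_rfl

theorem IsValid.measurable_queue_apply (hX : X.IsValid P) (t : ℕ) (l : Fin L) :
    Measurable fun ω => X.queue t ω l :=
  (measurable_pi_apply l).comp (hX.measurable_queue t)

theorem IsValid.memLp_queue [IsProbabilityMeasure P] (hX : X.IsValid P)
    (hb : M.IsBounded Y Z D B) (t : ℕ) (l : Fin L) (p : ℝ≥0∞) :
    MemLp (fun ω => X.queue t ω l) p P :=
  MemLp.of_bound (hX.measurable_queue_apply t l).aestronglyMeasurable ((N * Z + D) * t)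
    (by filter_upwards [hX.ae_abs_queue_le hb] with ω hω using hω t l)

theorem IsValid.integrable_queue [IsProbabilityMeasure P] (hX : X.IsValid P)
    (hb : M.IsBounded Y Z D B) (t : ℕ) (l : Fin L) : Integrable (fun ω => X.queue t ω l) P :=
  memLp_one_iff_integrable.1 (hX.memLp_queue hb t l 1)

theorem IsValid.integrable_queue_mul [IsProbabilityMeasure P] (hX : X.IsValid P)
    (hb : M.IsBounded Y Z D B) (t : ℕ) (l : Fin L) {g : Ω → ℝ} (hg : Integrable g P) :
    Integrable (fun ω => X.queue t ω l * g ω) P :=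
  hg.bdd_mul (hX.measurable_queue_apply t l).aestronglyMeasurable
    (c := (N * Z + D) * t)
    (by filter_upwards [hX.ae_abs_queue_le hb] with ω hω using hω t l)

theorem IsValid.integrable_queue_sq [IsProbabilityMeasure P] (hX : X.IsValid P)
    (hb : M.IsBounded Y Z D B) (t : ℕ) (l : Fin L) :
    Integrable (fun ω => X.queue t ω l ^ 2) P :=
  (hX.memLp_queue hb t l 2).integrable_sq

theorem IsValid.integrable_ext [IsProbabilityMeasure P] (hX : X.IsValid P)
    (hb : M.IsBounded Y Z D B) (t : ℕ) (l : Fin L) : Integrable (fun ω => X.ext t ω l) P :=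
  Integrable.of_bound ((measurable_pi_apply l).comp (hX.measurable_ext t)).aestronglyMeasurable D
    (by filter_upwards [hX.ae_abs_ext_le hb] with ω hω using hω t l)

theorem IsValid.integral_ext (hX : X.IsValid P) (t : ℕ) (l : Fin L) :
    ∫ ω, X.ext t ω l ∂P = M.dMean l := by
  unfold Model.dMean
  rw [← hX.ext_law t, integral_map (hX.measurable_ext t).aemeasurable
    (measurable_pi_apply l).aestronglyMeasurable]

/-- `Q[t]` depends only on slots before `t`, hence is independent of `d[t]`. -/
theorem IsValid.integral_queue_mul_ext (hX : X.IsValid P) (t : ℕ) (l : Fin L) :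
    ∫ ω, X.queue t ω l * X.ext t ω l ∂P = (∫ ω, X.queue t ω l ∂P) * M.dMean l := by
  have hi : IndepFun (fun ω => X.queue t ω l) (fun ω => X.ext t ω l) P := by
    rw [IndepFun_iff_Indep]
    refine indep_of_indep_of_le_left (indep_of_indep_of_le_right (hX.ext_indep t).symm ?_) ?_
    · exact ((measurable_pi_apply l).comp (comap_measurable (X.ext t))).comap_le
    · exact ((measurable_pi_apply l).comp (measurable_history_queue t)).comap_le
  rw [hi.integral_fun_mul_eq_mul_integral (hX.measurable_queue_apply t l).aestronglyMeasurable
    ((measurable_pi_apply l).comp (hX.measurable_ext t)).aestronglyMeasurable, hX.integral_ext]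

/-- The queue lengths dominate the violation of the constraints. -/
theorem IsValid.mul_avgMetric_le [IsProbabilityMeasure P] (hX : X.IsValid P)
    (hb : M.IsBounded Y Z D B) {T : ℕ} (hT : 0 < T) (l : Fin L) :
    T * X.avgMetric P l T - T * M.dMean l ≤ ∫ ω, X.queue T ω l ∂P := by
  rw [mul_avgMetric l T hT]
  have hstep : ∀ t, ∑ n, ∫ ω, X.metric n t ω l ∂P - M.dMean l ≤
      ∫ ω, X.queue (t + 1) ω l ∂P - ∫ ω, X.queue t ω l ∂P := by
    intro t
    rw [← integral_finsetSum _ fun n _ => hX.integrable_metric hb n t l, ← hX.integral_ext t l,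
      ← integral_sub (integrable_finsetSum _ fun n _ => hX.integrable_metric hb n t l)
        (hX.integrable_ext hb t l),
      ← integral_sub (hX.integrable_queue hb (t + 1) l) (hX.integrable_queue hb t l)]
    refine integral_mono ((integrable_finsetSum _ fun n _ => hX.integrable_metric hb n t l).sub
      (hX.integrable_ext hb t l)) ((hX.integrable_queue hb (t + 1) l).sub
      (hX.integrable_queue hb t l)) fun ω => ?_
    have : X.queue t ω l + ∑ n, X.metric n t ω l - X.ext t ω l ≤ X.queue (t + 1) ω l :=
      le_max_left _ _
    show ∑ n, X.metric n t ω l - X.ext t ω l ≤ X.queue (t + 1) ω l - X.queue t ω l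
    linarith
  have h := Finset.sum_le_sum fun t (_ : t ∈ range T) => hstep t
  rw [Finset.sum_range_sub (fun t => ∫ ω, X.queue t ω l ∂P), Finset.sum_sub_distrib] at h
  simpa [queue] using h

/-- One-step drift of the squared queue lengths. -/
theorem IsValid.integral_queue_sq_succ_le [IsProbabilityMeasure P] (hX : X.IsValid P)
    (hb : M.IsBounded Y Z D B) (t : ℕ) (l : Fin L) :
    ∫ ω, X.queue (t + 1) ω l ^ 2 ∂P ≤ ∫ ω, X.queue t ω l ^ 2 ∂P +
      2 * (∑ n, ∫ ω, X.queue t ω l * X.metric n t ω l ∂P -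
        (∫ ω, X.queue t ω l ∂P) * M.dMean l) + (N * Z + D) ^ 2 := by
  have i1 := hX.integrable_queue_sq hb t l
  have i2 := fun n => hX.integrable_queue_mul hb t l (hX.integrable_metric hb n t l)
  have i3 := hX.integrable_queue_mul hb t l (hX.integrable_ext hb t l)
  have i4 : Integrable (fun ω => ∑ n, X.queue t ω l * X.metric n t ω l -
      X.queue t ω l * X.ext t ω l) P := (integrable_finsetSum univ fun n _ => i2 n).sub i3
  have i5 : Integrable (fun ω => X.queue t ω l ^ 2 + 2 * (∑ n, X.queue t ω l * X.metric n t ω l -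
      X.queue t ω l * X.ext t ω l)) P := i1.add (i4.const_mul 2)
  rw [← hX.integral_queue_mul_ext, ← integral_finsetSum _ fun n _ => i2 n,
    ← integral_sub (integrable_finsetSum univ fun n _ => i2 n) i3, ← integral_const_mul,
    ← integral_add i1 (i4.const_mul 2)]
  have e : (N * Z + D) ^ 2 = ∫ _ω, (N * Z + D) ^ 2 ∂P := by simp
  rw [e, ← integral_add i5 (integrable_const _)]
  refine integral_mono_ae (hX.integrable_queue_sq hb (t + 1) l) (i5.add (integrable_const _)) ?_
  filter_upwards [hX.ae_abs_arrival_le hb] with ω hω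
  have h1 := sq_le_sq' (neg_le_of_abs_le (hω t l)) (le_of_abs_le (hω t l))
  have h2 : X.queue (t + 1) ω l ^ 2 ≤
      (X.queue t ω l + (∑ n, X.metric n t ω l - X.ext t ω l)) ^ 2 := by
    have e : X.queue (t + 1) ω l =
      max (X.queue t ω l + (∑ n, X.metric n t ω l - X.ext t ω l)) 0 := by
      rw [← add_sub_assoc]; rfl
    rw [e]
    rcases max_cases (X.queue t ω l + (∑ n, X.metric n t ω l - X.ext t ω l)) 0 with h | h
    · rw [h.1]
    · rw [h.1, zero_pow two_ne_zero]; exact sq_nonneg _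
  show X.queue (t + 1) ω l ^ 2 ≤ X.queue t ω l ^ 2 +
    2 * (∑ n, X.queue t ω l * X.metric n t ω l - X.queue t ω l * X.ext t ω l) +
      (N * Z + D) ^ 2
  rw [← Finset.mul_sum]
  nlinarith

/-- The algorithm pays at most the optimal ratio for the current queue lengths, up to a constant
per slot. -/
theorem IsValid.algorithm_cost_le [IsProbabilityMeasure P] (hX : X.IsValid P)
    (hb : M.IsBounded Y Z D B) (hY : 0 ≤ Y) (hZ : 0 ≤ Z) (hD : 0 ≤ D) {V : ℝ} (hV : 0 < V)
    (hA : X.FollowsAlgorithm P V) (n : Fin N) (T : ℕ) :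
    ∑ t ∈ range T, (V * ∫ ω, X.penalty n t ω ∂P +
      ∑ l, ∫ ω, X.queue t ω l * X.metric n t ω l ∂P -
        ∫ ω, M.bestRatio V n (X.queue t ω) ∂P) ≤
      2 * Y * B * V + 4 * L * (N * Z + D) * Z * B * T := by
  have := X.nonempty_action P n
  set E := N * Z + D with hE
  have hE0 : 0 ≤ E := by positivity
  have hmm : ∀ t, Measurable[X.history t] fun ω => M.bestRatio V n (X.queue t ω) := fun t =>
    (hb.continuous_bestRatio V n).measurable.comp (measurable_history_queue t)
  have hbest : ∀ t < T, ∀ᵐ ω ∂P, |M.bestRatio V n (X.queue t ω)| ≤ V * Y + L * (E * T) * Z := by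
    intro t ht
    filter_upwards [hX.ae_abs_queue_le hb] with ω hω
    have h := hb.abs_bestRatio_le (V := V) (R := E * T) (q := X.queue t ω) (fun l =>
      (hω t l).trans (mul_le_mul_of_nonneg_left (by exact_mod_cast ht.le) hE0)) n
    rwa [abs_of_pos hV] at h
  have i1 := fun t => (hX.integrable_penalty hb n t).const_mul V
  have i2 := fun t l => hX.integrable_queue_mul hb t l (hX.integrable_metric hb n t l)
  have i3 := fun t => integrable_finsetSum univ fun l _ => i2 t l
  have i4 : ∀ t < T, Integrable (fun ω => M.bestRatio V n (X.queue t ω)) P := fun t ht =>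
    Integrable.of_bound ((hmm t).mono (hX.history_le t) le_rfl).aestronglyMeasurable _ (hbest t ht)
  -- Half of `K` comes from freezing the queue in the cost, half from the Lipschitz bound on
  -- `bestRatio`. The crude queue bound `E * T` suffices, since it enters only through the single
  -- truncated frame and so contributes `O(T)`.
  have key := hX.sum_integral_le hb hY hZ n T (V := V) (R := E * T)
    (R' := V * Y + L * (E * T) * Z) (K := 2 * (L * E * Z)) (by positivity) (by positivity)
    (by positivity) (W := X.queue) (b := fun t ω => M.bestRatio V n (X.queue t ω))
    measurable_history_queue hmm
    (fun t ht => by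
      filter_upwards [hX.ae_abs_queue_le hb] with ω hω l
      exact (hω t l).trans (mul_le_mul_of_nonneg_left (by exact_mod_cast ht.le) hE0))
    hbest
    (fun k t _ => by
      filter_upwards [hA n k] with ω hω ht
      rw [ht] at hω
      exact le_ciInf hω)
    (F := fun t ω => V * X.penalty n t ω + ∑ l, X.queue t ω l * X.metric n t ω l -
      M.bestRatio V n (X.queue t ω))
    (fun t ht => ((i1 t).add (i3 t)).sub (i4 t ht))
    (by
      filter_upwards [hX.ae_abs_queue_sub_le hb, hX.ae_abs_metric_le hb n] with ω h1 h2 t i _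
      have h3 := hb.bestRatio_le_add (V := V) (R := E * i) (q := X.queue t ω)
        (q' := X.queue (t + i) ω) (fun l => by rw [abs_sub_comm]; exact h1 t i l) n
      have h4 := le_of_abs_le (abs_slotCost_le (V := 0) (y := 0) (Y := 0) (R := E * i)
        (q := fun l => X.queue (t + i) ω l - X.queue t ω l) (by simp) (h2 (t + i)) (h1 t i))
      simp only [sub_mul, Finset.sum_sub_distrib] at h4
      simp only [abs_zero, zero_add, mul_zero] at h4
      nlinarith)
  have hint : ∀ t ∈ range T, ∫ ω, (V * X.penalty n t ω + ∑ l, X.queue t ω l * X.metric n t ω l -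
      M.bestRatio V n (X.queue t ω)) ∂P = V * ∫ ω, X.penalty n t ω ∂P +
      ∑ l, ∫ ω, X.queue t ω l * X.metric n t ω l ∂P -
        ∫ ω, M.bestRatio V n (X.queue t ω) ∂P := by
    intro t ht
    have i5 : Integrable (fun ω => V * X.penalty n t ω +
        ∑ l, X.queue t ω l * X.metric n t ω l) P := (i1 t).add (i3 t)
    rw [integral_sub i5 (i4 t (Finset.mem_range.1 ht)),
      integral_add (i1 t) (i3 t), integral_finsetSum _ fun l _ => i2 t l, integral_const_mul]
  rw [Finset.sum_congr rfl hint, abs_of_pos hV] at key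
  refine key.trans (le_of_eq ?_)
  ring

theorem IsValid.integrable_bestRatio_queue [IsProbabilityMeasure P] (hX : X.IsValid P)
    (hb : M.IsBounded Y Z D B) (V : ℝ) (n : Fin N) (t : ℕ) :
    Integrable (fun ω => M.bestRatio V n (X.queue t ω)) P := by
  have := X.nonempty_action P n
  refine Integrable.of_bound ((hb.continuous_bestRatio V n).measurable.comp
    (hX.measurable_queue t)).aestronglyMeasurable (|V| * Y + L * ((N * Z + D) * t) * Z) ?_
  filter_upwards [hX.ae_abs_queue_le hb] with ω hω
  exact hb.abs_bestRatio_le (hω t) n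

/-- The drift-plus-penalty bound for the algorithm. -/
theorem IsValid.drift_plus_penalty_le [IsProbabilityMeasure P] (hX : X.IsValid P)
    (hb : M.IsBounded Y Z D B) (hY : 0 ≤ Y) (hZ : 0 ≤ Z) (hD : 0 ≤ D) (hf : M.IsFeasible)
    {V : ℝ} (hV : 0 < V) (hA : X.FollowsAlgorithm P V) {T : ℕ} (hT : 0 < T) :
    V * (T * X.avgPenalty P T) + (∑ l, ∫ ω, X.queue T ω l ^ 2 ∂P) / 2 ≤
      T * (V * M.optValue) +
        (N * (4 * L * (N * Z + D) * Z * B) + L * (N * Z + D) ^ 2 / 2) * T +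
        N * (2 * Y * B) * V := by
  let y : ℕ → ℝ := fun t => ∑ n, ∫ ω, X.penalty n t ω ∂P
  let c : ℕ → ℝ := fun t => ∑ n, ∑ l, ∫ ω, X.queue t ω l * X.metric n t ω l ∂P
  let m : ℕ → ℝ := fun t => ∑ n, ∫ ω, M.bestRatio V n (X.queue t ω) ∂P
  let d : ℕ → ℝ := fun t => ∑ l, (∫ ω, X.queue t ω l ∂P) * M.dMean l
  have h1 : ∑ l, ∫ ω, X.queue T ω l ^ 2 ∂P ≤
      ∑ t ∈ range T, (2 * (c t - d t) + L * (N * Z + D) ^ 2) := by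
    have hs : ∀ t, 2 * (c t - d t) + L * (N * Z + D) ^ 2 ≥
        ∑ l, ∫ ω, X.queue (t + 1) ω l ^ 2 ∂P - ∑ l, ∫ ω, X.queue t ω l ^ 2 ∂P := by
      intro t
      have := Finset.sum_le_sum fun l (_ : l ∈ univ) => hX.integral_queue_sq_succ_le hb t l
      rw [Finset.sum_add_distrib, Finset.sum_add_distrib, ← Finset.mul_sum,
        Finset.sum_sub_distrib, Finset.sum_comm (s := univ (α := Fin L))] at this
      simp only [Finset.sum_const, Finset.card_univ, Fintype.card_fin, nsmul_eq_mul] at this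
      simp only [c, d]
      linarith
    have := Finset.sum_le_sum fun t (_ : t ∈ range T) => hs t
    rw [Finset.sum_range_sub (fun t => ∑ l, ∫ ω, X.queue t ω l ^ 2 ∂P)] at this
    simpa [queue] using this
  have h2 : ∑ t ∈ range T, (V * y t + c t - m t) ≤
      N * (2 * Y * B * V + 4 * L * (N * Z + D) * Z * B * T) := by
    have := Finset.sum_le_sum fun n (_ : n ∈ univ) =>
      hX.algorithm_cost_le hb hY hZ hD hV hA n T
    rw [Finset.sum_comm] at this
    simp only [Finset.sum_const, Finset.card_univ, Fintype.card_fin, nsmul_eq_mul] at this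
    refine le_trans (le_of_eq (Finset.sum_congr rfl fun t _ => ?_)) this
    simp only [y, c, m, Finset.sum_sub_distrib, Finset.sum_add_distrib, Finset.mul_sum]
  -- All systems are now compared at the same queue vector `Q[t]`, so weak duality applies pathwise
  -- in each slot, wherever the frames stand.
  have h3 : ∀ t, m t ≤ V * M.optValue + d t := by
    intro t
    have i1 : ∀ l, Integrable (fun ω => X.queue t ω l * M.dMean l) P := fun l =>
      (hX.integrable_queue hb t l).mul_const _
    have := integral_mono (integrable_finsetSum univ fun n _ =>
      hX.integrable_bestRatio_queue hb V n t) ((integrable_const (V * M.optValue)).add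
        (integrable_finsetSum univ fun l _ => i1 l)) fun ω =>
      hf.sum_bestRatio_le hb hY hZ hV (q := X.queue t ω) fun l => queue_nonneg t ω l
    rw [integral_finsetSum _ fun n _ => hX.integrable_bestRatio_queue hb V n t] at this
    refine this.trans (le_of_eq ?_)
    refine (integral_add (integrable_const (V * M.optValue))
      (integrable_finsetSum univ fun l _ => i1 l)).trans ?_
    rw [integral_finsetSum _ fun l _ => i1 l]
    simp [d, integral_mul_const]
  have h4 := Finset.sum_le_sum fun t (_ : t ∈ range T) => h3 t
  rw [mul_avgPenalty T hT]
  change V * ∑ t ∈ range T, y t + _ ≤ _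
  simp only [Finset.sum_add_distrib, Finset.sum_sub_distrib, ← Finset.mul_sum, Finset.sum_const,
    Finset.card_range, nsmul_eq_mul] at h1 h2 h4
  linarith

end SystemRun

/-! ### From the two bounds to the performance guarantees. -/

/-- The arithmetic that turns the drift-plus-penalty bound and the Lagrangian lower bound into the
performance guarantees. -/
theorem performance_of_bounds {L : ℕ} {ε T f S c₁ c₂ c₃ : ℝ} {γ d z q q2 : Fin L → ℝ}
    (hε : 0 < ε) (hε1 : ε < 1) (hT : 1 / ε ^ 2 ≤ T) (hc₁ : 0 ≤ c₁) (hc₂ : 0 ≤ c₂) (hc₃ : 0 ≤ c₃)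
    (hγ : ∀ l, 0 ≤ γ l) (hq2 : ∀ l, 0 ≤ q2 l)
    (hdrift : 1 / ε * (T * S) + (∑ l, q2 l) / 2 ≤ T * (1 / ε * f) + c₁ * T + c₂ * (1 / ε))
    (hdual : T * (f + ∑ l, γ l * d l) ≤ T * (1 * S + ∑ l, γ l * z l) + c₃)
    (hz : ∀ l, T * z l - T * d l ≤ q l) (hq : ∀ l c, c * q l ≤ q2 l / 4 + c ^ 2) :
    S ≤ f + (∑ l, γ l ^ 2 + 2 * c₁ + 2 * c₂ + c₃ + 1) * ε ∧
      ∀ l, z l ≤ d l + (∑ l, γ l ^ 2 + 2 * c₁ + 2 * c₂ + c₃ + 1) * ε := by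
  have hT0 : 0 < T := lt_of_lt_of_le (by positivity) hT
  have hΓ : 0 ≤ ∑ l, γ l ^ 2 := Finset.sum_nonneg fun l _ => sq_nonneg _
  have hsum2 : 0 ≤ ∑ l, q2 l := Finset.sum_nonneg fun l _ => hq2 l
  have hεT : 1 ≤ ε ^ 2 * T := by
    rw [div_le_iff₀ (by positivity)] at hT; linarith
  have hεT1 : 1 ≤ ε * T := by nlinarith
  set V := 1 / ε with hV
  have hVε : V * ε = 1 := by rw [hV]; field_simp
  have hV0 : 0 < V := by positivity
  have hV2 : V ^ 2 ≤ T := by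
    have : V ^ 2 = 1 / ε ^ 2 := by rw [hV]; field_simp
    rw [this]; exact hT
  have hV1 : V ≤ T := by
    have : 1 ≤ V := by rw [hV, le_div_iff₀ hε]; linarith
    nlinarith
  constructor
  -- The queue term in the drift bound is nonnegative and is dropped.
  · have h1 : V * (T * S) ≤ V * (T * f + c₁ * (ε * T) + c₂) := by
      have : V * (T * f + c₁ * (ε * T) + c₂) = T * (V * f) + c₁ * T * (V * ε) + c₂ * V := by ring
      rw [this, hVε]; linarith
    have h2 := le_of_mul_le_mul_left h1 hV0
    have h3 : c₂ ≤ c₂ * (ε * T) := le_mul_of_one_le_right hc₂ hεT1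
    have h4 : T * S ≤ T * (f + (c₁ + c₂) * ε) := by nlinarith
    have h5 := le_of_mul_le_mul_left h4 hT0
    have h6 : (c₁ + c₂) * ε ≤ (∑ l, γ l ^ 2 + 2 * c₁ + 2 * c₂ + c₃ + 1) * ε :=
      mul_le_mul_of_nonneg_right (by linarith) hε.le
    linarith
  · set c₄ := ∑ l, γ l ^ 2 + c₁ + c₂ + c₃ with hc₄
    -- Young's inequality `hq` with `c = V γ l` uses up only half of the available `½ ∑ q2`.
    have h1 : ∑ l, V * γ l * (T * z l - T * d l) ≤ (∑ l, q2 l) / 4 + V ^ 2 * ∑ l, γ l ^ 2 := by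
      rw [Finset.sum_div, Finset.mul_sum, ← Finset.sum_add_distrib]
      refine Finset.sum_le_sum fun l _ => ?_
      have a := mul_le_mul_of_nonneg_left (hz l) (mul_nonneg hV0.le (hγ l))
      have b := hq l (V * γ l)
      rw [mul_pow] at b
      exact a.trans b
    have h2 : ∑ l, V * γ l * (T * z l - T * d l) =
        V * (T * ∑ l, γ l * z l - T * ∑ l, γ l * d l) := by
      simp only [Finset.mul_sum, ← Finset.sum_sub_distrib]
      exact Finset.sum_congr rfl fun l _ => by ring
    have h3 := mul_le_mul_of_nonneg_left hdual hV0.le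
    have h4 : (∑ l, q2 l) / 4 ≤ V ^ 2 * ∑ l, γ l ^ 2 + c₁ * T + (c₂ + c₃) * V := by
      rw [h2] at h1; nlinarith
    have h5 : (∑ l, q2 l) / 4 ≤ c₄ * T := by
      have a := mul_le_mul_of_nonneg_right hV2 hΓ
      have b := mul_le_mul_of_nonneg_left hV1 (add_nonneg hc₂ hc₃)
      rw [hc₄]; linarith
    intro l
    -- The scale `ε T` is the target size of the queue: `T ≤ (ε T)²` because `ε² T ≥ 1`, so `q2 l /
    -- 4 ≤ c₄ T` gives `q l ≤ (c₄ + 1) ε T`.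
    have h6 := hq l (ε * T)
    have h7 : q2 l ≤ ∑ l, q2 l := Finset.single_le_sum (fun l _ => hq2 l) (Finset.mem_univ l)
    have hc₄0 : 0 ≤ c₄ := by positivity
    have h8 : c₄ * T ≤ c₄ * (ε * T) ^ 2 := by
      refine mul_le_mul_of_nonneg_left ?_ hc₄0
      nlinarith
    have h9 : (ε * T) * q l ≤ (ε * T) * ((c₄ + 1) * (ε * T)) := by nlinarith
    have h10 := le_of_mul_le_mul_left h9 (by positivity)
    have h11 : T * z l ≤ T * (d l + (c₄ + 1) * ε) := by linarith [hz l]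
    have h12 := le_of_mul_le_mul_left h11 hT0
    have h13 : (c₄ + 1) * ε ≤ (∑ l, γ l ^ 2 + 2 * c₁ + 2 * c₂ + c₃ + 1) * ε :=
      mul_le_mul_of_nonneg_right (by linarith) hε.le
    linarith

end

end AsyncRenewal

theorem mainTheorem2 (N L : ℕ) (ymax zmax dmax B : ℝ) (γ : Fin L → ℝ) :
    ∃ C : ℝ, 0 ≤ C ∧
      ∀ M : AsyncRenewal.Model.{u} N L,
        M.IsBounded ymax zmax dmax B → M.HasCompactPerf → M.IsFeasible →
        M.IsLagrangeMultiplier γ →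
        ∀ ε : ℝ, 0 < ε → ε < 1 →
        ∀ (Ω : Type v) (_ : MeasurableSpace Ω) (P : MeasureTheory.Measure Ω)
          (_ : MeasureTheory.IsProbabilityMeasure P) (X : AsyncRenewal.SystemRun M Ω),
          X.IsValid P → X.FollowsAlgorithm P (1 / ε) →
          ∀ T : ℕ, 1 / ε ^ 2 ≤ (T : ℝ) →
            X.avgPenalty P T ≤ M.optValue + C * ε ∧
              ∀ l : Fin L, X.avgMetric P l T ≤ M.dMean l + C * ε := by
  -- The constant is chosen before the model, so values of `B` admitting no bounded model are set
  -- aside to keep it nonnegative.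
  rcases lt_or_ge B 1 with hB | hB
  · exact ⟨0, le_rfl, fun M hb => absurd hb.one_le (not_le.2 hB)⟩
  set Y := |ymax|
  set Z := |zmax|
  set D := |dmax|
  have hY : 0 ≤ Y := abs_nonneg _
  have hZ : 0 ≤ Z := abs_nonneg _
  have hD : 0 ≤ D := abs_nonneg _
  have hB0 : 0 ≤ B := zero_le_one.trans hB
  set c₁ : ℝ := N * (4 * L * (N * Z + D) * Z * B) + L * (N * Z + D) ^ 2 / 2
  set c₂ : ℝ := N * (2 * Y * B)
  set c₃ : ℝ := N * (2 * (|(1 : ℝ)| * Y + L * ‖γ‖ * Z) * B)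
  have hc₁ : 0 ≤ c₁ := by positivity
  have hc₂ : 0 ≤ c₂ := by positivity
  have hc₃ : 0 ≤ c₃ := by positivity
  refine ⟨∑ l, γ l ^ 2 + 2 * c₁ + 2 * c₂ + c₃ + 1,
    by have := Finset.sum_nonneg fun l (_ : l ∈ univ) => sq_nonneg (γ l); linarith, ?_⟩
  intro M hb0 _ hf hγ ε hε hε1 Ω mΩ P hP X hX hA T hT
  have hb : M.IsBounded Y Z D B := hb0.abs
  have hT0 : 0 < T := by
    have : (0 : ℝ) < T := lt_of_lt_of_le (by positivity) hT
    exact_mod_cast this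
  have := X.nonempty_action P
  refine AsyncRenewal.performance_of_bounds (q := fun l => ∫ ω, X.queue T ω l ∂P)
    (q2 := fun l => ∫ ω, X.queue T ω l ^ 2 ∂P) hε hε1 hT hc₁ hc₂ hc₃ hγ.1
    (fun l => integral_nonneg fun ω => sq_nonneg _)
    (hX.drift_plus_penalty_le hb hY hZ hD hf (by positivity) hA hT0) ?_
    (hX.mul_avgMetric_le hb hT0) ?_
  · exact (mul_le_mul_of_nonneg_left (hγ.le_sum_bestRatio hb) (Nat.cast_nonneg T)).trans
      (hX.mul_sum_bestRatio_le hb hY hZ hT0 1 (norm_nonneg γ) (norm_le_pi_norm γ))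
  -- Integrated form of `(Q / 2 - c)² ≥ 0`.
  · intro l c
    rw [← integral_const_mul, ← integral_div]
    have e : c ^ 2 = ∫ _ω, c ^ 2 ∂P := by simp
    have i := (hX.integrable_queue_sq hb T l).div_const 4
    rw [e, ← integral_add i (integrable_const _)]
    refine integral_mono ((hX.integrable_queue hb T l).const_mul c)
      (i.add (integrable_const _)) fun ω => ?_
    show c * X.queue T ω l ≤ X.queue T ω l ^ 2 / 4 + c ^ 2
    nlinarith [sq_nonneg (X.queue T ω l / 2 - c)]
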